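/- **Setting.** Let $L>0$, let $J\subseteq\mathbb R$ be an interval, and let $q(x,t)$, $x\in\mathbb R$, $t\in J$, be a classical solution of the focusing nonlinear Schrödinger equation $\mathrm i q_t+q_{xx}+2|q|^2q=0$ with $q(x+L,t)=q(x,t)$ (that is, $q,q_x,q_{xx},q_t$ exist and are continuous on $\mathbb R\times J$; time derivatives at end points of $J$ belonging to $J$ are one-sided). Let $\sigma_3=\mathrm{diag}(1,-1)$, let $^*$ be complex conjugation, and put $$Q=\begin{pmatrix}0&q\\-q^*&0\end{pmatrix},\qquad \mathcal L=\mathrm i\sigma_3(\partial_x-Q),\qquad U=\frac1{\sqrt2}\begin{pmatrix}1&1\\-\mathrm i&\mathrm i\end{pmatrix}.$$ For $z\in\mathbb C$ let $Y(x,t,z)$ be the $2\times2$ matrix solution of $Y_x=(-\mathrm iz\sigma_3+Q)Y$ with $Y(0,t,z)=\mathbb I$ (this system is $\mathcal Lv=zv$), and let $\tilde Y=UYU^{-1}=(\tilde y_{ij})$. A prime on $\tilde y_{12}$ denotes $\partial/\partial z$. Let $\Delta(t,z)=\frac12\operatorname{tr}Y(L,t,z)$. The main spectrum is the zero set of $\Delta^2-1$.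 The Lax spectrum $\Sigma=\Sigma(t)$ is the set of $z\in\mathbb C$ for which $\mathcal L\phi=z\phi$ has a nontrivial bounded solution on $\mathbb R$, and $\Sigma^o$ is $\Sigma$ without the main spectrum. For each $t$ let $\rho=\rho(t,\cdot)$ be a function with $\rho^2-2\Delta\rho+1=0$ on $\mathbb C$ and $|\rho|<1$ off $\Sigma$; at each point of $\Sigma$ either root may be chosen. The Dirichlet spectrum at time $t$ is the set of $\mu\in\mathbb C$ for which $\mathcal Lv=\mu v$ has a nontrivial solution $v\in H^1([0,L],\mathbb C^2)$ with $v_1+v_2=0$ at $x=0$ and at $x=L$. For a Dirichlet eigenvalue $\mu$ at time $t$, the sign $\nu\in\{-1,0,1\}$ is defined as follows: if $\mu\in\Sigma^o$, then $\nu=1$ if $\tilde y_{22}(L,t,\mu)=\rho(\mu)$ and $\nu=-1$ if $\tilde y_{22}(L,t,\mu)=1/\rho(\mu)$; otherwise $\nu=-\operatorname{sgn}\log|\tilde y_{22}(L,t,\mu)|$, with $\operatorname{sgn}0=0$. Let $\mu_n:J\to\mathbb C$, $n\in\mathbb Z$, be continuous functions such that $\mu_n(t)$ is a Dirichlet eigenvalue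 at time $t$ for all $n$ and all $t\in J$, and let $\nu_n(t)$ be the sign of $\mu_n(t)$. **Proposition.** Let $n\in\mathbb Z$ and $t\in J$. 1. If $\tilde y_{12}'(L,t,\mu_n(t))\neq0$, that is, if $\mu_n(t)$ is a simple zero of $\tilde y_{12}(L,t,\cdot)$, then $\mu_n$ is differentiable at $t$ (relative to $J$) and $$\frac{d\mu_n}{dt}(t)=\nu_n(t)\,c_1(\mu_n(t))\,\frac{\rho(\mu_n(t))-\rho^{-1}(\mu_n(t))}{\tilde y_{12}'(L,t,\mu_n(t))},$$ where $$c_1(z)=-2z^2+\mathrm iz\big(q^*(0,t)+q(0,t)\big)+|q(0,t)|^2+\tfrac12\big(q_x^*(0,t)-q_x(0,t)\big).$$ 2. Suppose that at every time $s\in J$ all Dirichlet eigenvalues are simple zeros of $\tilde y_{12}(L,s,\cdot)$, except those that coincide with a real zero of $\Delta^2-1$ of multiplicity $m>2$, whose multiplicity as zeros of $\tilde y_{12}(L,s,\cdot)$ is $m/2$. If $\tilde y_{12}'(L,t,\mu_n(t))=0$ (so that the quotient above is not defined), then $\nu_n(t)=0$, and $\mu_n$ is differentiable at $t$ (relative to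 $J$) with $\frac{d\mu_n}{dt}(t)=0$. -/

import Mathlib

open MeasureTheory
open scoped Matrix ComplexConjugate

namespace ZakharovShabat

noncomputable section

/-- The third Pauli matrix `σ₃ = diag(1, -1)`. -/
def sigma3 : Matrix (Fin 2) (Fin 2) ℂ := !![1, 0; 0, -1]

/-- The matrix potential `Q = (0, q; -q*, 0)` at a point where the potential has the value `q`. -/
def potentialMatrix (q : ℂ) : Matrix (Fin 2) (Fin 2) ℂ := !![0, q; -conj q, 0]

/-- The expression `i σ₃ (∂ₓ v - Q v)` of the Dirac operator `𝓛` at the point `x`,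
`dv` being the value of the derivative of `v` at `x` and `v` the value of the function at `x`. -/
def diracExpr (q : ℝ → ℂ) (x : ℝ) (v dv : Fin 2 → ℂ) : Fin 2 → ℂ :=
  Complex.I • (sigma3 *ᵥ (dv - potentialMatrix (q x) *ᵥ v))

/-- The Lax spectrum `Σ(𝓛)`: all `z` for which `𝓛 φ = z φ` has a bounded nontrivial solution
on the whole line. -/
def laxSpectrum (q : ℝ → ℂ) : Set ℂ :=
  {z | ∃ φ : ℝ → Fin 2 → ℂ, Differentiable ℝ φ ∧
    (∀ x, diracExpr q x (φ x) (deriv φ x) = z • φ x) ∧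
    (∃ x, φ x ≠ 0) ∧ ∃ C : ℝ, ∀ x, ‖φ x‖ ≤ C}

/-- `v` belongs to `H¹([a, b], ℂ²)` and has the weak derivative `w`: on an interval this says that
`w ∈ L²` and that `v` is (the continuous representative given by) a primitive of `w`. -/
def IsH1With (a b : ℝ) (v w : ℝ → Fin 2 → ℂ) : Prop :=
  MemLp w 2 (volume.restrict (Set.Icc a b)) ∧
    ∀ x ∈ Set.Icc a b, v x = v a + ∫ s in a..x, w s

/-- The Dirichlet spectrum with base point `xo`: all `μ` for which `𝓛 v = μ v` has a nontrivial
solution `v ∈ H¹([xo, xo + L], ℂ²)` such that `v₁ + v₂` vanishes at `xo` and at `xo + L`. -/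
def dirichletSpectrum (L : ℝ) (q : ℝ → ℂ) (xo : ℝ) : Set ℂ :=
  {μ | ∃ v w : ℝ → Fin 2 → ℂ, IsH1With xo (xo + L) v w ∧
    (∃ x ∈ Set.Icc xo (xo + L), v x ≠ 0) ∧
    (∀ᵐ x ∂volume.restrict (Set.Icc xo (xo + L)), diracExpr q x (v x) (w x) = μ • v x) ∧
    v xo 0 + v xo 1 = 0 ∧ v (xo + L) 0 + v (xo + L) 1 = 0}

/-- `Y` is the principal matrix solution of the Zakharov-Shabat system
`Y' = (-i z σ₃ + Q) Y`, `Y(0) = 1` (derivatives are taken entrywise). -/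
def IsPrincipalSolution (q : ℝ → ℂ) (z : ℂ) (Y : ℝ → Matrix (Fin 2) (Fin 2) ℂ) : Prop :=
  Y 0 = 1 ∧ ∀ x i j, HasDerivAt (fun s => Y s i j)
    (((-(Complex.I * z) • sigma3 + potentialMatrix (q x)) * Y x) i j) x

open Classical in
/-- The principal matrix solution `Y(x, z)`. For continuous `q` it exists and is unique,
so that the default value is not used. -/
def principalSolution (q : ℝ → ℂ) (x : ℝ) (z : ℂ) : Matrix (Fin 2) (Fin 2) ℂ :=
  if h : ∃ Y, IsPrincipalSolution q z Y then h.choose x else 0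

/-- The matrix `U = (1, 1; -i, i) / √2`. -/
def similarityU : Matrix (Fin 2) (Fin 2) ℂ :=
  ((Real.sqrt 2 : ℝ) : ℂ)⁻¹ • !![1, 1; -Complex.I, Complex.I]

/-- The modified matrix solution `Ỹ(x, z) = U Y(x, z) U⁻¹`. Its entry `ỹ_{ij}` is the entry
with the indices `i - 1, j - 1` here. -/
def modifiedSolution (q : ℝ → ℂ) (x : ℝ) (z : ℂ) : Matrix (Fin 2) (Fin 2) ℂ :=
  similarityU * principalSolution q x z * similarityU⁻¹

/-- The Floquet discriminant: half of the trace of the monodromy matrix `Y(L, z)`. -/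
def discriminant (L : ℝ) (q : ℝ → ℂ) (z : ℂ) : ℂ :=
  (principalSolution q L z).trace / 2

/-- The main spectrum: the zeros of `Δ² - 1`. -/
def mainSpectrum (L : ℝ) (q : ℝ → ℂ) : Set ℂ :=
  {z | discriminant L q z ^ 2 - 1 = 0}

/-- `ρ` is a determination of the Floquet multiplier: a root of `ρ² - 2Δρ + 1 = 0` at each point,
and off the Lax spectrum the root with `|ρ| < 1` (which makes it unique and analytic there).
On the Lax spectrum either root is admitted at each point; the choice of the boundary value
from above on the real line and from the left on the other bands is a special case. -/
def IsFloquetMultiplier (L : ℝ) (q : ℝ → ℂ) (ρ : ℂ → ℂ) : Prop :=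
  (∀ z, ρ z ^ 2 - 2 * discriminant L q z * ρ z + 1 = 0) ∧ ∀ z, z ∉ laxSpectrum q → ‖ρ z‖ < 1

open Classical in
/-- The sign `ν` attached to a Dirichlet eigenvalue `μ`. On the Lax spectrum without the main
spectrum it is `1` if `ỹ₂₂(L, μ) = ρ(μ)` and `-1` if `ỹ₂₂(L, μ) = 1 / ρ(μ)`
(there is no third case at a Dirichlet eigenvalue);
elsewhere it is `- sgn (log |ỹ₂₂(L, μ)|)`, with `sgn 0 = 0`. -/
def dirichletSign (L : ℝ) (q : ℝ → ℂ) (ρ : ℂ → ℂ) (μ : ℂ) : ℝ :=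
  if μ ∈ laxSpectrum q \ mainSpectrum L q then
    if modifiedSolution q L μ 1 1 = ρ μ then 1
    else if modifiedSolution q L μ 1 1 = (ρ μ)⁻¹ then -1
    else 0
  else -(SignType.sign (Real.log ‖modifiedSolution q L μ 1 1‖) : ℝ)

/-- All Dirichlet eigenvalues with base point `0` are simple zeros of `ỹ₁₂(L, ·)`, except those
which coincide with a real zero of `Δ² - 1` of multiplicity `m > 2`: these have
multiplicity `m / 2`. -/
def DirichletMultiplicities (L : ℝ) (q : ℝ → ℂ) : Prop :=
  ∀ μ ∈ dirichletSpectrum L q 0,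
    (∀ m : ℕ, μ.im = 0 → 2 < m →
      analyticOrderAt (fun z => discriminant L q z ^ 2 - 1) μ = (m : ℕ∞) →
        2 * analyticOrderAt (fun z => modifiedSolution q L z 0 1) μ = (m : ℕ∞)) ∧
    ((¬ ∃ m : ℕ, μ.im = 0 ∧ 2 < m ∧
      analyticOrderAt (fun z => discriminant L q z ^ 2 - 1) μ = (m : ℕ∞)) →
        analyticOrderAt (fun z => modifiedSolution q L z 0 1) μ = 1)

/-- `q(x, t)` is a classical solution, `L`-periodic in `x`, of the focusing NLS equation
`i q_t + q_xx + 2 |q|² q = 0` for `x ∈ ℝ` and times `t ∈ J`; time derivatives at end points of `J`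
are one-sided. -/
structure IsPeriodicNLSSolution (L : ℝ) (J : Set ℝ) (q : ℝ → ℝ → ℂ) : Prop where
  periodic : ∀ t ∈ J, ∀ x, q (x + L) t = q x t
  contDiff_space : ∀ t ∈ J, ContDiff ℝ 2 (fun x => q x t)
  differentiable_time : ∀ x, DifferentiableOn ℝ (q x) J
  continuous_q : ContinuousOn (fun p : ℝ × ℝ => q p.1 p.2) (Set.univ ×ˢ J)
  continuous_qx :
    ContinuousOn (fun p : ℝ × ℝ => deriv (fun x => q x p.2) p.1) (Set.univ ×ˢ J)
  continuous_qxx :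
    ContinuousOn (fun p : ℝ × ℝ => deriv (deriv (fun x => q x p.2)) p.1) (Set.univ ×ˢ J)
  continuous_qt :
    ContinuousOn (fun p : ℝ × ℝ => derivWithin (q p.1) J p.2) (Set.univ ×ˢ J)
  equation : ∀ x, ∀ t ∈ J,
    Complex.I * derivWithin (q x) J t + deriv (deriv (fun y => q y t)) x
      + 2 * (‖q x t‖ : ℂ) ^ 2 * q x t = 0

/-- `c₁(z) = -2z² + i z (q* + q) + |q|² + ½ (q_x* - q_x)` with `q` and `q_x` taken at `(0, t)`. -/
def c1 (q : ℝ → ℝ → ℂ) (t : ℝ) (z : ℂ) : ℂ :=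
  -2 * z ^ 2 + Complex.I * z * (conj (q 0 t) + q 0 t) + (‖q 0 t‖ : ℂ) ^ 2
    + (1 / 2) * (conj (deriv (fun x => q x t) 0) - deriv (fun x => q x t) 0)

end

end ZakharovShabat

open ZakharovShabat

/-! The Dirichlet eigenvalues are the zeros of `ỹ₁₂(L, t, ·)`, so `ỹ₁₂(L, s, μ(s)) = 0` for all `s`
and the motion of `μ` is an implicit differentiation. The Lax pair and periodicity give `∂ₜ M = [V,
M]` for the monodromy matrix `M = Y(L)`, where `V` is the time matrix at `x = 0`. At a zero of `ỹ₁₂`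
the conjugated monodromy is triangular with diagonal entries `1/ỹ₂₂` and `ỹ₂₂`, so the relevant
entry of the commutator is `-c₁ (ỹ₂₂ - 1/ỹ₂₂)` (`commutator_timeMatrix_apply`), and the sign `ν` is
made so that `ỹ₂₂ - 1/ỹ₂₂ = ν (ρ - 1/ρ)` (`dirichletSign_mul`).

For the second claim, a commutator has trace zero, so `Δ` is constant in time. A multiple zero of
`ỹ₁₂` is a real point of the main spectrum; there `M` is an element of `SU(2)` with trace `±2`,
hence `±1`, and `ỹ₁₂` vanishes at that point at every time, always to the order `m/2`. A zero of
constant order in a continuous family of entire functions is isolated uniformly in the parameter, so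
`μ` is locally constant (`eventually_eq_of_multiple`).

All derivatives are found by writing increments as the step times a continuous quotient. In time,
variation of constants supplies a quotient jointly continuous in time and `z`
(`exists_monodromy_sub_eq_smul`), which also handles end points of `J`. -/

open Filter Topology Set

/-! ### Linear differential equations with a parameter, by Picard series. -/

namespace LinearFlow

noncomputable section

variable {P 𝔸 : Type*} [NormedRing 𝔸]

/-- Compactness of `[-R, R]` makes one bound serve a whole neighbourhood of `p`, which the M-test
for joint continuity requires. -/
theorem eventually_norm_le [TopologicalSpace P] {A : P → ℝ → 𝔸}
    (hA : Continuous (Function.uncurry A)) (p : P) (R : ℝ) :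
    ∃ C, 0 ≤ C ∧ ∀ᶠ p' in 𝓝 p, ∀ s, |s| ≤ R → ‖A p' s‖ ≤ C := by
  obtain ⟨C, hC⟩ := (isCompact_Icc (a := -R) (b := R)).exists_bound_of_continuousOn
    (f := A p) (hA.comp (Continuous.prodMk_right p)).continuousOn
  refine ⟨|C| + 1, by positivity, ?_⟩
  have := (isCompact_Icc (a := -R) (b := R)).eventually_forall_of_forall_eventually
    (x₀ := p) (P := fun p' s => ‖A p' s‖ ≤ |C| + 1) (fun s hs => by
      have h1 : ‖Function.uncurry A (p, s)‖ < |C| + 1 :=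
        ((hC s hs).trans (le_abs_self C)).trans_lt (by linarith)
      exact (hA.norm.continuousAt.eventually_lt continuousAt_const h1).mono fun _ h => h.le)
  exact this.mono fun p' h s hs => h s (abs_le.mp hs)

variable [NormedAlgebra ℝ 𝔸]

/-- The terms of the Picard series of the initial value problem `Y' = A Y`, `Y 0 = 1`. -/
def picardTerm (A : P → ℝ → 𝔸) : ℕ → P → ℝ → 𝔸
  | 0, _, _ => 1
  | n + 1, p, x => ∫ s in (0 : ℝ)..x, A p s * picardTerm A n p s

theorem continuous_picardTerm [TopologicalSpace P] [FirstCountableTopology P] {A : P → ℝ → 𝔸}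
    (hA : Continuous (Function.uncurry A)) (n : ℕ) :
    Continuous (Function.uncurry (picardTerm A n)) := by
  induction n with
  | zero => exact continuous_const
  | succ n ih =>
    exact intervalIntegral.continuous_parametric_primitive_of_continuous
      (f := fun p s => A p s * picardTerm A n p s) (hA.mul ih)

/-- The factor `‖1‖` remains because the norm of the unit is not assumed to be `1`. -/
theorem norm_picardTerm_le {A : P → ℝ → 𝔸} {p : P} {R C : ℝ} (hC : 0 ≤ C)
    (h : ∀ s, |s| ≤ R → ‖A p s‖ ≤ C) (n : ℕ) {x : ℝ} (hx : |x| ≤ R) :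
    ‖picardTerm A n p x‖ ≤ ‖(1 : 𝔸)‖ * (C * |x|) ^ n / n.factorial := by
  induction n generalizing x with
  | zero => simp [picardTerm]
  | succ n ih =>
    have hle : ∀ s ∈ uIoc 0 x, ‖A p s * picardTerm A n p s‖ ≤
        (‖(1 : 𝔸)‖ * C ^ (n + 1) / n.factorial) * |s - 0| ^ n := by
      intro s hs
      have hs' : |s| ≤ R := by
        have := abs_sub_left_of_mem_uIcc (uIoc_subset_uIcc hs)
        simp only [sub_zero] at this
        exact this.trans hx
      calc ‖A p s * picardTerm A n p s‖
          ≤ C * (‖(1 : 𝔸)‖ * (C * |s|) ^ n / n.factorial) :=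
            (norm_mul_le _ _).trans (mul_le_mul (h s hs') (ih hs') (norm_nonneg _) hC)
        _ = _ := by rw [sub_zero]; ring
    have hint : IntegrableOn (fun s : ℝ =>
        (‖(1 : 𝔸)‖ * C ^ (n + 1) / n.factorial) * |s - 0| ^ n) (uIoc 0 x) := by
      have : Continuous fun s : ℝ =>
        (‖(1 : 𝔸)‖ * C ^ (n + 1) / n.factorial) * |s - 0| ^ n := by fun_prop
      exact (this.intervalIntegrable 0 x).def'
    calc ‖picardTerm A (n + 1) p x‖ ≤ ∫ s in uIoc 0 x, ‖A p s * picardTerm A n p s‖ :=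
          intervalIntegral.norm_integral_le_integral_norm_uIoc
      _ ≤ ∫ s in uIoc 0 x, (‖(1 : 𝔸)‖ * C ^ (n + 1) / n.factorial) * |s - 0| ^ n :=
          integral_mono_of_nonneg (Eventually.of_forall fun _ => norm_nonneg _) hint
            ((ae_restrict_mem measurableSet_uIoc).mono hle)
      _ = _ := by
          rw [integral_const_mul, integral_pow_abs_sub_uIoc, Nat.factorial_succ]
          push_cast
          rw [sub_zero]
          field_simp
          ring

/-- The solution of `Y' = A Y`, `Y 0 = 1`, as the sum of its Picard series. -/
def flow (A : P → ℝ → 𝔸) (p : P) (x : ℝ) : 𝔸 := ∑' n, picardTerm A n p x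

theorem flow_zero (A : P → ℝ → 𝔸) (p : P) : flow A p 0 = 1 := by
  rw [flow, tsum_eq_single 0]
  · rfl
  · intro n hn
    obtain ⟨m, rfl⟩ := Nat.exists_eq_succ_of_ne_zero hn
    simp [picardTerm]

theorem summable_bound (K C R : ℝ) :
    Summable fun n : ℕ => K * (C * R) ^ n / n.factorial := by
  simpa only [mul_div_assoc] using (Real.summable_pow_div_factorial (C * R)).mul_left K

theorem norm_picardTerm_le_of_le {A : P → ℝ → 𝔸} {p : P} {R C : ℝ} (hC : 0 ≤ C)
    (h : ∀ s, |s| ≤ R → ‖A p s‖ ≤ C) (n : ℕ) {x : ℝ} (hx : |x| ≤ R) :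
    ‖picardTerm A n p x‖ ≤ ‖(1 : 𝔸)‖ * (C * R) ^ n / n.factorial :=
  (norm_picardTerm_le hC h n hx).trans (by gcongr)

variable [TopologicalSpace P] [CompleteSpace 𝔸]

theorem continuous_flow [FirstCountableTopology P] {A : P → ℝ → 𝔸}
    (hA : Continuous (Function.uncurry A)) : Continuous (Function.uncurry (flow A)) := by
  rw [continuous_iff_continuousAt]
  rintro ⟨p, x⟩
  obtain ⟨C, hC, hev⟩ := eventually_norm_le hA p (|x| + 1)
  have hcont : ContinuousOn (fun r : P × ℝ => ∑' n, picardTerm A n r.1 r.2)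
      ({p' | ∀ s, |s| ≤ |x| + 1 → ‖A p' s‖ ≤ C} ×ˢ {y | |y| ≤ |x| + 1}) :=
    continuousOn_tsum (fun n => (continuous_picardTerm hA n).continuousOn)
      (summable_bound _ _ _) fun n r hr => norm_picardTerm_le_of_le hC hr.1 n hr.2
  refine hcont.continuousAt (prod_mem_nhds hev ?_)
  have : ∀ᶠ y in 𝓝 x, |y| < |x| + 1 :=
    continuous_abs.continuousAt.eventually_lt continuousAt_const (by linarith)
  exact this.mono fun _ h => h.le

theorem hasDerivAt_flow [FirstCountableTopology P] {A : P → ℝ → 𝔸}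
    (hA : Continuous (Function.uncurry A)) (p : P) (x : ℝ) :
    HasDerivAt (flow A p) (A p x * flow A p x) x := by
  obtain ⟨C, hC, hev⟩ := eventually_norm_le hA p (|x| + 1)
  have hb := hev.self_of_nhds
  have hAp : Continuous (A p) := hA.comp (Continuous.prodMk_right p)
  have hT : ∀ n, Continuous (picardTerm A n p) := fun n =>
    (continuous_picardTerm hA n).comp (Continuous.prodMk_right p)
  have hmem : ∀ y ∈ Metric.ball (0 : ℝ) (|x| + 1), |y| ≤ |x| + 1 := fun y hy => by
    simpa using (mem_ball_zero_iff.mp hy).le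
  have hsum : ∀ y, |y| ≤ |x| + 1 → Summable fun n => picardTerm A n p y := fun y hy =>
    Summable.of_norm_bounded (summable_bound _ _ _)
      fun n => norm_picardTerm_le_of_le hC hb n hy
  have hx : x ∈ Metric.ball (0 : ℝ) (|x| + 1) := by simp
  -- The series is shifted by one: every term but the constant zeroth one is a primitive, and the
  -- derivatives of the shifted terms are `A` times the original terms.
  have hS := hasDerivAt_tsum_of_isPreconnected
    (g := fun n => picardTerm A (n + 1) p) (g' := fun n y => A p y * picardTerm A n p y)
    ((summable_bound ‖(1 : 𝔸)‖ C (|x| + 1)).mul_left C) Metric.isOpen_ball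
    (convex_ball (0 : ℝ) (|x| + 1)).isPreconnected
    (fun n y _ => (hAp.mul (hT n)).integral_hasStrictDerivAt 0 y |>.hasDerivAt)
    (fun n y hy => (norm_mul_le _ _).trans (mul_le_mul (hb y (hmem y hy))
      (norm_picardTerm_le_of_le hC hb n (hmem y hy)) (norm_nonneg _) hC))
    hx ((summable_nat_add_iff 1).mpr (hsum x (hmem x hx))) hx
  rw [(hsum x (hmem x hx)).tsum_mul_left] at hS
  refine (hS.const_add 1).congr_of_eventuallyEq ?_
  filter_upwards [Metric.isOpen_ball.mem_nhds hx] with y hy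
  exact (hsum y (hmem y hy)).tsum_eq_zero_add

end

end LinearFlow

/-! ### Zeros of constant order in continuous families of entire functions. -/

theorem differentiable_dslope {f : ℂ → ℂ} (hf : Differentiable ℂ f) (c : ℂ) :
    Differentiable ℂ (dslope f c) := by
  rw [← differentiableOn_univ] at hf ⊢
  exact (Complex.differentiableOn_dslope univ_mem).mpr hf

theorem analyticOrderAt_dslope_add_one {f : ℂ → ℂ} (hf : Differentiable ℂ f) {c : ℂ}
    (h0 : f c = 0) : analyticOrderAt f c = analyticOrderAt (dslope f c) c + 1 := by
  have hg := differentiable_dslope hf c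
  have hfg : f = (fun z => z - c) * dslope f c := by
    ext z
    simpa [h0] using (sub_smul_dslope f c z).symm
  conv_lhs => rw [hfg]
  rw [analyticOrderAt_mul (by fun_prop) (hg.analyticAt c), analyticOrderAt_id_sub_const_self,
    add_comm]

/-- Near `c` the quotient cannot be estimated directly. On a circle around `c` the denominator has
constant modulus, and the maximum principle carries the estimate inside. -/
theorem continuous_dslope_of_continuous {S : Type*} [TopologicalSpace S] {F : S → ℂ → ℂ}
    (hF : Continuous (Function.uncurry F)) (hd : ∀ s, Differentiable ℂ (F s)) {c : ℂ}
    (h0 : ∀ s, F s c = 0) : Continuous (Function.uncurry fun s => dslope (F s) c) := by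
  have hg := fun s => differentiable_dslope (hd s) c
  rw [continuous_iff_continuousAt]
  rintro ⟨s, z⟩
  rw [Metric.continuousAt_iff']
  intro ε hε
  set R : ℝ := dist z c + 1 with hR
  have hRpos : 0 < R := by positivity
  have hsphere : ∀ᶠ s' in 𝓝 s, ∀ w ∈ Metric.sphere c R, ‖F s' w - F s w‖ ≤ ε / 2 * R := by
    refine (isCompact_sphere c R).eventually_forall_of_forall_eventually
      (P := fun s' w => ‖F s' w - F s w‖ ≤ ε / 2 * R) fun w _ => ?_
    have hc : Continuous fun r : S × ℂ => ‖F r.1 r.2 - F s r.2‖ :=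
      (hF.sub ((hd s).continuous.comp continuous_snd)).norm
    exact (hc.continuousAt.eventually_lt (g := fun _ => ε / 2 * R) (x₀ := (s, w))
      continuousAt_const (by simpa using by positivity)).mono fun _ h => h.le
  have hball : ∀ᶠ w in 𝓝 z, w ∈ Metric.ball c R :=
    Metric.isOpen_ball.mem_nhds (by simp [hR])
  have hz : ∀ᶠ w in 𝓝 z, dist (dslope (F s) c w) (dslope (F s) c z) < ε / 2 :=
    Metric.continuousAt_iff'.mp (hg s).continuous.continuousAt _ (half_pos hε)
  rw [nhds_prod_eq]
  filter_upwards [hsphere.prod_mk (hball.and hz)] with r ⟨h1, h2, h3⟩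
  have hmax : ‖dslope (F r.1) c r.2 - dslope (F s) c r.2‖ ≤ ε / 2 := by
    refine Complex.norm_le_of_forall_mem_frontier_norm_le
      (f := fun w => dslope (F r.1) c w - dslope (F s) c w) Metric.isBounded_ball
      ((hg r.1).sub (hg s)).diffContOnCl (fun w hw => ?_) (subset_closure h2)
    rw [frontier_ball c hRpos.ne'] at hw
    have hwc : w ≠ c := Metric.ne_of_mem_sphere hw hRpos.ne'
    have hn : ‖w - c‖ = R := by rw [← dist_eq_norm]; exact hw
    rw [dslope_of_ne _ hwc, dslope_of_ne _ hwc, slope_def_field, slope_def_field, h0, h0,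
      sub_zero, sub_zero, ← sub_div, norm_div, hn, div_le_iff₀ hRpos]
    exact h1 w hw
  calc dist (dslope (F r.1) c r.2) (dslope (F s) c z)
      ≤ dist (dslope (F r.1) c r.2) (dslope (F s) c r.2)
        + dist (dslope (F s) c r.2) (dslope (F s) c z) := dist_triangle _ _ _
    _ < ε := by rw [dist_eq_norm]; linarith

/-- If the members of a continuous family of entire functions all vanish at `c` to the same
finite order, then near `c` the nearby members have no other zero. -/
theorem eventually_eq_of_zero_of_analyticOrderAt_eq {S : Type*} [TopologicalSpace S]
    {F : S → ℂ → ℂ} (hF : Continuous (Function.uncurry F)) (hd : ∀ s, Differentiable ℂ (F s))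
    {c : ℂ} {k : ℕ} (hk : ∀ s, analyticOrderAt (F s) c = k) (s₀ : S) :
    ∀ᶠ r : S × ℂ in 𝓝 (s₀, c), F r.1 r.2 = 0 → r.2 = c := by
  -- Dividing by `z - c` lowers the order by one and keeps the family continuous; at order zero,
  -- nonvanishing is an open condition.
  induction k generalizing F with
  | zero =>
    have h : Function.uncurry F (s₀, c) ≠ 0 :=
      ((hd s₀).analyticAt c).analyticOrderAt_eq_zero.mp (by simpa using hk s₀)
    filter_upwards [hF.continuousAt.eventually_ne h] with r hr h0
    exact absurd h0 hr
  | succ k ih =>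
    have h0 : ∀ s, F s c = 0 := fun s =>
      apply_eq_zero_of_analyticOrderAt_ne_zero (by rw [hk s]; simp)
    have hg := fun s => differentiable_dslope (hd s) c
    have hord : ∀ s, analyticOrderAt (dslope (F s) c) c = k := fun s => by
      have := hk s
      rw [analyticOrderAt_dslope_add_one (hd s) (h0 s)] at this
      push_cast at this
      exact (ENat.add_left_injective_of_ne_top (by simp)) this
    filter_upwards [ih (continuous_dslope_of_continuous hF hd h0) hg hord] with r hr hz
    by_contra hne
    refine hne (hr ?_)
    rw [dslope_of_ne _ hne, slope_def_field, hz, h0]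
    simp

attribute [local instance] Matrix.linftyOpNormedRing Matrix.linftyOpNormedAlgebra

/-! ### The principal solution: existence, uniqueness, continuity in parameters. -/

namespace ZakharovShabat

noncomputable section

/-- The operator norm provides the normed algebra used by the Picard series; derivatives see only
its topology, which is the entrywise one. -/
theorem hasDerivAt_matrix_iff {𝕜 : Type*} [NontriviallyNormedField 𝕜] [NormedAlgebra 𝕜 ℂ]
    {f : 𝕜 → Matrix (Fin 2) (Fin 2) ℂ}
    {f' : Matrix (Fin 2) (Fin 2) ℂ} {x : 𝕜} :
    HasDerivAt f f' x ↔ ∀ i j, HasDerivAt (fun s => f s i j) (f' i j) x := by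
  have h1 := hasDerivAt_pi (𝕜 := 𝕜) (φ := fun s => (f s : Fin 2 → Fin 2 → ℂ)) (φ' := f') (x := x)
  simp only [hasDerivAt_pi] at h1
  exact h1

/-- The coefficient matrix `-i z σ₃ + Q` of the Zakharov-Shabat system. -/
def zsMatrix (q : ℝ → ℂ) (z : ℂ) (x : ℝ) : Matrix (Fin 2) (Fin 2) ℂ :=
  -(Complex.I * z) • sigma3 + potentialMatrix (q x)

theorem zsMatrix_eq (q : ℝ → ℂ) (z : ℂ) (x : ℝ) :
    zsMatrix q z x = !![-(Complex.I * z), q x; -conj (q x), Complex.I * z] := by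
  ext i j
  fin_cases i <;> fin_cases j <;> simp [zsMatrix, sigma3, potentialMatrix]

theorem continuous_potentialMatrix : Continuous potentialMatrix := by
  refine continuous_matrix fun i j => ?_
  fin_cases i <;> fin_cases j <;> simp [potentialMatrix] <;> fun_prop

theorem continuous_zsMatrix {P : Type*} [TopologicalSpace P] {u : P → ℝ → ℂ} {ζ : P → ℂ}
    (hu : Continuous (Function.uncurry u)) (hζ : Continuous ζ) :
    Continuous (Function.uncurry fun p x => zsMatrix (u p) (ζ p) x) := by
  have h1 : Continuous fun r : P × ℝ => ζ r.1 := hζ.comp continuous_fst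
  exact ((continuous_const.mul h1).neg.smul continuous_const).add
    (continuous_potentialMatrix.comp hu)

theorem continuous_zsMatrix_left {q : ℝ → ℂ} (hq : Continuous q) (z : ℂ) :
    Continuous (zsMatrix q z) :=
  (continuous_zsMatrix (P := Unit) (u := fun _ => q) (ζ := fun _ => z)
    (hq.comp continuous_snd) continuous_const).comp (Continuous.prodMk_right ())

theorem isPrincipalSolution_iff {q : ℝ → ℂ} {z : ℂ} {Y : ℝ → Matrix (Fin 2) (Fin 2) ℂ} :
    IsPrincipalSolution q z Y ↔ Y 0 = 1 ∧ ∀ x, HasDerivAt Y (zsMatrix q z x * Y x) x := by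
  simp only [hasDerivAt_matrix_iff]
  rfl

/-- The coefficient matrix `A` has trace zero, so its adjugate is `-A`, and the adjugate of a
solution solves the adjoint equation. It serves as the inverse of `Y` throughout, and its entries
are linear in those of `Y`. -/
theorem hasDerivAt_adjugate {q : ℝ → ℂ} {z : ℂ} {Y : ℝ → Matrix (Fin 2) (Fin 2) ℂ} {x : ℝ}
    (hY : HasDerivAt Y (zsMatrix q z x * Y x) x) :
    HasDerivAt (fun x => (Y x).adjugate) (-((Y x).adjugate * zsMatrix q z x)) x := by
  rw [hasDerivAt_matrix_iff] at hY ⊢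
  simp only [zsMatrix_eq, Matrix.adjugate_fin_two] at hY ⊢
  intro i j
  fin_cases i <;> fin_cases j
  · refine (hY 1 1).congr_deriv ?_
    simp [Matrix.mul_apply, Fin.sum_univ_two]; ring
  · refine (hY 0 1).neg.congr_deriv ?_
    simp [Matrix.mul_apply, Fin.sum_univ_two]; ring
  · refine (hY 1 0).neg.congr_deriv ?_
    simp [Matrix.mul_apply, Fin.sum_univ_two]; ring
  · refine (hY 0 0).congr_deriv ?_
    simp [Matrix.mul_apply, Fin.sum_univ_two]; ring

theorem IsPrincipalSolution.adjugate_mul {q : ℝ → ℂ} {z : ℂ}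
    {Y : ℝ → Matrix (Fin 2) (Fin 2) ℂ} (hY : IsPrincipalSolution q z Y) (x : ℝ) :
    (Y x).adjugate * Y x = 1 := by
  rw [isPrincipalSolution_iff] at hY
  have hd : ∀ x, HasDerivAt (fun x => (Y x).adjugate * Y x) 0 x := fun x =>
    ((hasDerivAt_adjugate (hY.2 x)).mul (hY.2 x)).congr_deriv (by noncomm_ring)
  have := is_const_of_deriv_eq_zero (fun x => (hd x).differentiableAt)
    (fun x => (hd x).deriv) x 0
  simpa [hY.1] using this

theorem IsPrincipalSolution.mul_adjugate {q : ℝ → ℂ} {z : ℂ}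
    {Y : ℝ → Matrix (Fin 2) (Fin 2) ℂ} (hY : IsPrincipalSolution q z Y) (x : ℝ) :
    Y x * (Y x).adjugate = 1 :=
  mul_eq_one_comm.mp (hY.adjugate_mul x)

theorem IsPrincipalSolution.unique {q : ℝ → ℂ} {z : ℂ}
    {Y W : ℝ → Matrix (Fin 2) (Fin 2) ℂ} (hY : IsPrincipalSolution q z Y)
    (hW : IsPrincipalSolution q z W) : W = Y := by
  have hY' := isPrincipalSolution_iff.mp hY
  have hW' := isPrincipalSolution_iff.mp hW
  have hd : ∀ x, HasDerivAt (fun x => (Y x).adjugate * W x) 0 x := fun x =>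
    ((hasDerivAt_adjugate (hY'.2 x)).mul (hW'.2 x)).congr_deriv (by noncomm_ring)
  funext x
  have := is_const_of_deriv_eq_zero (fun x => (hd x).differentiableAt)
    (fun x => (hd x).deriv) x 0
  have h1 : (Y x).adjugate * W x = 1 := by simpa [hY'.1, hW'.1] using this
  calc W x = Y x * ((Y x).adjugate * W x) := by rw [← mul_assoc, hY.mul_adjugate, one_mul]
    _ = Y x := by rw [h1, mul_one]

section Parametric

variable {P : Type*} [TopologicalSpace P] [FirstCountableTopology P] {u : P → ℝ → ℂ} {ζ : P → ℂ}

theorem isPrincipalSolution_flow (hu : Continuous (Function.uncurry u)) (hζ : Continuous ζ)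
    (p : P) :
    IsPrincipalSolution (u p) (ζ p) (LinearFlow.flow (fun p x => zsMatrix (u p) (ζ p) x) p) :=
  isPrincipalSolution_iff.mpr ⟨LinearFlow.flow_zero _ _, fun x =>
    LinearFlow.hasDerivAt_flow (continuous_zsMatrix hu hζ) p x⟩

theorem principalSolution_eq {q : ℝ → ℂ} {z : ℂ} {Y : ℝ → Matrix (Fin 2) (Fin 2) ℂ}
    (hY : IsPrincipalSolution q z Y) (x : ℝ) : principalSolution q x z = Y x := by
  have h : ∃ Y, IsPrincipalSolution q z Y := ⟨Y, hY⟩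
  rw [principalSolution, dif_pos h, hY.unique h.choose_spec]

theorem continuous_principalSolution (hu : Continuous (Function.uncurry u)) (hζ : Continuous ζ) :
    Continuous fun r : P × ℝ => principalSolution (u r.1) r.2 (ζ r.1) := by
  have : (fun r : P × ℝ => principalSolution (u r.1) r.2 (ζ r.1)) =
      Function.uncurry (LinearFlow.flow fun p x => zsMatrix (u p) (ζ p) x) := by
    funext r
    exact principalSolution_eq (isPrincipalSolution_flow hu hζ r.1) r.2
  rw [this]
  exact LinearFlow.continuous_flow (continuous_zsMatrix hu hζ)

end Parametric

theorem isPrincipalSolution_principalSolution {q : ℝ → ℂ} (hq : Continuous q) (z : ℂ) :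
    IsPrincipalSolution q z fun x => principalSolution q x z := by
  have h := isPrincipalSolution_flow (P := Unit) (u := fun _ => q) (ζ := fun _ => z)
    (hq.comp continuous_snd) continuous_const ()
  rwa [← funext (principalSolution_eq h)] at h

end

end ZakharovShabat

/-! ### Variation of constants and analyticity in the spectral parameter. -/

/-- Carathéodory's form of the derivative, used below for `Y` in `z`, for `Δ` in time and for `μ`.
-/
theorem hasDerivWithinAt_of_sub_eq_smul {𝕜 E : Type*} [NontriviallyNormedField 𝕜]
    [NormedAddCommGroup E] [NormedSpace 𝕜 E] {f g : 𝕜 → E} {s : Set 𝕜} {x : 𝕜}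
    (h : ∀ y ∈ s, f y - f x = (y - x) • g y) (hg : ContinuousWithinAt g s x) :
    HasDerivWithinAt f (g x) s x := by
  rw [hasDerivWithinAt_iff_tendsto_slope]
  refine (hg.tendsto.mono_left (nhdsWithin_mono x sdiff_subset)).congr' ?_
  filter_upwards [self_mem_nhdsWithin] with y hy
  rw [slope_def_module, h y hy.1, inv_smul_smul₀ (sub_ne_zero.mpr hy.2)]

namespace ZakharovShabat

noncomputable section

theorem hasDerivAt_principalSolution {q : ℝ → ℂ} (hq : Continuous q) (z : ℂ) (x : ℝ) :
    HasDerivAt (fun x => principalSolution q x z) (zsMatrix q z x * principalSolution q x z) x :=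
  (isPrincipalSolution_iff.mp (isPrincipalSolution_principalSolution hq z)).2 x

theorem principalSolution_zero {q : ℝ → ℂ} (hq : Continuous q) (z : ℂ) :
    principalSolution q 0 z = 1 :=
  (isPrincipalSolution_principalSolution hq z).1

theorem principalSolution_mul_adjugate {q : ℝ → ℂ} (hq : Continuous q) (z : ℂ) (x : ℝ) :
    principalSolution q x z * (principalSolution q x z).adjugate = 1 :=
  (isPrincipalSolution_principalSolution hq z).mul_adjugate x

theorem det_principalSolution {q : ℝ → ℂ} (hq : Continuous q) (z : ℂ) (x : ℝ) :
    (principalSolution q x z).det = 1 := by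
  have h := principalSolution_mul_adjugate hq z x
  rw [Matrix.mul_adjugate] at h
  simpa using congrFun (congrFun h 0) 0

theorem continuous_principalSolution_left {q : ℝ → ℂ} (hq : Continuous q) (z : ℂ) :
    Continuous fun x => principalSolution q x z :=
  continuous_iff_continuousAt.mpr fun x => (hasDerivAt_principalSolution hq z x).continuousAt

theorem continuous_principalSolution_uncurry {q : ℝ → ℂ} (hq : Continuous q) :
    Continuous fun r : ℂ × ℝ => principalSolution q r.2 r.1 :=
  continuous_principalSolution (P := ℂ) (u := fun _ => q) (ζ := id) (hq.comp continuous_snd)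
    continuous_id

/-- The variation of constants formula for the difference of two principal solutions. -/
theorem principalSolution_sub {q₁ q₂ : ℝ → ℂ} (h₁ : Continuous q₁) (h₂ : Continuous q₂)
    (z₁ z₂ : ℂ) (x : ℝ) :
    principalSolution q₂ x z₂ - principalSolution q₁ x z₁ = principalSolution q₁ x z₁ *
      ∫ s in (0 : ℝ)..x, (principalSolution q₁ s z₁).adjugate *
        (zsMatrix q₂ z₂ s - zsMatrix q₁ z₁ s) * principalSolution q₂ s z₂ := by
  have hd : ∀ s, HasDerivAt
      (fun s => (principalSolution q₁ s z₁).adjugate * principalSolution q₂ s z₂)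
      ((principalSolution q₁ s z₁).adjugate *
        (zsMatrix q₂ z₂ s - zsMatrix q₁ z₁ s) * principalSolution q₂ s z₂) s := fun s =>
    ((hasDerivAt_adjugate (hasDerivAt_principalSolution h₁ z₁ s)).mul
      (hasDerivAt_principalSolution h₂ z₂ s)).congr_deriv (by noncomm_ring)
  have hc : Continuous fun s => (principalSolution q₁ s z₁).adjugate *
      (zsMatrix q₂ z₂ s - zsMatrix q₁ z₁ s) * principalSolution q₂ s z₂ :=
    (((continuous_principalSolution_left h₁ z₁).matrix_adjugate).mul
      ((continuous_zsMatrix_left h₂ z₂).sub (continuous_zsMatrix_left h₁ z₁))).mul (continuous_principalSolution_left h₂ z₂)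
  rw [intervalIntegral.integral_eq_sub_of_hasDerivAt (fun s _ => hd s)
    (hc.intervalIntegrable _ _), principalSolution_zero h₁, principalSolution_zero h₂, mul_sub,
    ← mul_assoc, principalSolution_mul_adjugate h₁]
  simp

/-- With equal potentials, variation of constants exhibits the increment as `z - z₀` times an
integral continuous in `z`. -/
theorem differentiable_principalSolution {q : ℝ → ℂ} (hq : Continuous q) (x : ℝ) :
    Differentiable ℂ (principalSolution q x) := by
  intro z₀
  set g : ℂ → Matrix (Fin 2) (Fin 2) ℂ := fun z => principalSolution q x z₀ *
    ∫ s in (0 : ℝ)..x, (principalSolution q s z₀).adjugate *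
        (-Complex.I • sigma3) * principalSolution q s z with hg
  have hc : Continuous g := by
    refine continuous_const.mul
      (intervalIntegral.continuous_parametric_intervalIntegral_of_continuous' ?_ 0 x)
    exact (((continuous_principalSolution_left hq z₀).matrix_adjugate.comp continuous_snd).mul
      continuous_const).mul (continuous_principalSolution_uncurry hq)
  have h := hasDerivWithinAt_of_sub_eq_smul (f := principalSolution q x) (g := g) (s := univ)
    (x := z₀) (fun z _ => ?_) hc.continuousWithinAt
  · exact (hasDerivWithinAt_univ.mp h).differentiableAt
  · rw [principalSolution_sub hq hq z₀ z x, hg, ← mul_smul_comm,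
      ← intervalIntegral.integral_smul]
    congr 2
    funext s
    have : zsMatrix q z s - zsMatrix q z₀ s = (z - z₀) • (-Complex.I • sigma3) := by
      simp only [zsMatrix, smul_smul]
      rw [add_sub_add_right_eq_sub, ← sub_smul]
      congr 1
      ring
    rw [this, mul_smul_comm, smul_mul_assoc]

theorem differentiable_principalSolution_apply {q : ℝ → ℂ} (hq : Continuous q) (x : ℝ)
    (i j : Fin 2) : Differentiable ℂ fun z => principalSolution q x z i j := fun z =>
  (hasDerivAt_matrix_iff.mp (differentiable_principalSolution hq x z).hasDerivAt i
    j).differentiableAt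

/-! ### Time dependence of the monodromy matrix through the Lax pair. -/

open Classical in
/-- The difference quotient of `q x` between `t` and `s`, continued by the derivative at `s = t`. -/
def timeSlope (J : Set ℝ) (q : ℝ → ℝ → ℂ) (t x s : ℝ) : ℂ :=
  if s = t then derivWithin (q x) J t else (s - t)⁻¹ • (q x s - q x t)

theorem sub_eq_smul_timeSlope (J : Set ℝ) (q : ℝ → ℝ → ℂ) (t x s : ℝ) :
    q x s - q x t = (s - t) • timeSlope J q t x s := by
  by_cases h : s = t
  · simp [h]
  · rw [timeSlope, if_neg h, smul_inv_smul₀ (sub_ne_zero.mpr h)]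

namespace IsPeriodicNLSSolution

variable {L : ℝ} {J : Set ℝ} {q : ℝ → ℝ → ℂ}

theorem continuous_space (hq : IsPeriodicNLSSolution L J q) {t : ℝ} (ht : t ∈ J) :
    Continuous fun x => q x t :=
  (hq.contDiff_space t ht).continuous

theorem continuous_subtype (hq : IsPeriodicNLSSolution L J q) :
    Continuous fun r : ℝ × J => q r.1 r.2 :=
  hq.continuous_q.comp_continuous (continuous_fst.prodMk (continuous_subtype_val.comp
    continuous_snd)) fun r => ⟨mem_univ _, r.2.2⟩

/-- The only delicate points have `s = t`. There the mean value inequality on the convex set `J ∩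
ball t δ`, applied to `q x τ - τ d`, reduces the claim to joint continuity of `q_t`. -/
theorem continuous_timeSlope (hq : IsPeriodicNLSSolution L J q) (hJ : J.OrdConnected)
    {t : ℝ} (ht : t ∈ J) : Continuous fun r : ℝ × J => timeSlope J q t r.1 r.2 := by
  have hqt : Continuous fun r : ℝ × J => derivWithin (q r.1) J r.2 :=
    hq.continuous_qt.comp_continuous (continuous_fst.prodMk (continuous_subtype_val.comp
      continuous_snd)) fun r => ⟨mem_univ _, r.2.2⟩
  rw [continuous_iff_continuousAt]
  rintro ⟨x₀, s₀⟩
  by_cases hs : (s₀ : ℝ) = t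
  · obtain rfl : s₀ = ⟨t, ht⟩ := Subtype.ext hs
    rw [Metric.continuousAt_iff]
    intro ε hε
    obtain ⟨δ, hδ, h⟩ := Metric.continuousAt_iff.mp
      (hqt.continuousAt (x := (x₀, (⟨t, ht⟩ : J)))) (ε / 2) (half_pos hε)
    refine ⟨δ, hδ, ?_⟩
    rintro ⟨x, s⟩ hr
    have hx : dist x x₀ < δ := (le_max_left _ _).trans_lt hr
    have hsd : dist (s : ℝ) t < δ := (le_max_right (dist x x₀) _).trans_lt hr
    have hval : ∀ τ ∈ J, dist τ t < δ →
        dist (derivWithin (q x) J τ) (derivWithin (q x₀) J t) < ε / 2 := fun τ hτ hd =>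
      @h (x, ⟨τ, hτ⟩) (max_lt hx hd)
    set d := derivWithin (q x₀) J t with hdd
    suffices dist (timeSlope J q t x s) d ≤ ε / 2 by
      simp only [timeSlope, if_true] at this ⊢
      linarith
    by_cases hst : (s : ℝ) = t
    · rw [timeSlope, if_pos hst]
      exact (hval t ht (by simpa using hδ)).le
    have hK : Convex ℝ (J ∩ Metric.ball t δ) := hJ.convex.inter (convex_ball t δ)
    have hbound := hK.norm_image_sub_le_of_norm_hasDerivWithin_le (C := ε / 2)
      (f := fun τ => q x τ - τ • d) (f' := fun τ => derivWithin (q x) J τ - d)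
      (x := t) (y := s)
      (fun τ hτ => (((hq.differentiable_time x τ hτ.1).hasDerivWithinAt.mono
        inter_subset_left).sub (((hasDerivWithinAt_id τ _).smul_const d))).congr_deriv (by simp))
      (fun τ hτ => by
        rw [← dist_eq_norm]
        exact (hval τ hτ.1 hτ.2).le)
      ⟨ht, Metric.mem_ball_self hδ⟩ ⟨s.2, hsd⟩
    have hne : (s : ℝ) - t ≠ 0 := sub_ne_zero.mpr hst
    rw [timeSlope, if_neg hst, dist_eq_norm]
    have heq : ((s : ℝ) - t)⁻¹ • (q x s - q x t) - d
        = ((s : ℝ) - t)⁻¹ • ((q x s - (s : ℝ) • d) - (q x t - t • d)) := by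
      have : (q x s - (s : ℝ) • d) - (q x t - t • d) = (q x s - q x t) - ((s : ℝ) - t) • d := by
        rw [sub_smul]; abel
      rw [this, smul_sub _ (q x s - q x t), inv_smul_smul₀ hne]
    rw [heq, norm_smul, norm_inv, inv_mul_le_iff₀ (norm_pos_iff.mpr hne), mul_comm]
    exact hbound
  · have hne : ∀ᶠ r : ℝ × J in 𝓝 (x₀, s₀), (r.2 : ℝ) ≠ t :=
      (continuous_subtype_val.comp continuous_snd).continuousAt.eventually_ne hs
    have hc : ContinuousAt (fun r : ℝ × J => ((r.2 : ℝ) - t)⁻¹ • (q r.1 r.2 - q r.1 t))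
        (x₀, s₀) :=
      ContinuousAt.smul (f := fun r : ℝ × J => ((r.2 : ℝ) - t)⁻¹)
        (ContinuousAt.inv₀ (by fun_prop) (sub_ne_zero.mpr hs))
        (hq.continuous_subtype.sub
          ((hq.continuous_space ht).comp continuous_fst)).continuousAt
    exact hc.congr (hne.mono fun r hr => (if_neg hr).symm)

end IsPeriodicNLSSolution

/-- The matrix of the time part of the Lax pair of the focusing NLS equation. -/
def timeMatrix (q : ℝ → ℂ) (z : ℂ) (x : ℝ) : Matrix (Fin 2) (Fin 2) ℂ :=
  !![-2 * Complex.I * z ^ 2 + Complex.I * (q x * conj (q x)),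
      2 * z * q x + Complex.I * deriv q x;
    -(2 * z * conj (q x)) + Complex.I * conj (deriv q x),
      2 * Complex.I * z ^ 2 - Complex.I * (q x * conj (q x))]

/-- This is the zero curvature equation `V_x = Q_t + [A, V]` with `q_t` already replaced by its
value from the NLS equation, so that only a potential at a fixed time is involved. -/
theorem hasDerivAt_timeMatrix {q : ℝ → ℂ} (hq : ContDiff ℝ 2 q) (z : ℂ) (x : ℝ) :
    HasDerivAt (timeMatrix q z)
      (potentialMatrix (Complex.I * (deriv (deriv q) x + 2 * (‖q x‖ : ℂ) ^ 2 * q x))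
        + zsMatrix q z x * timeMatrix q z x - timeMatrix q z x * zsMatrix q z x) x := by
  have h1 : HasDerivAt q (deriv q x) x :=
    (hq.differentiable (by norm_num)).differentiableAt.hasDerivAt
  have h2 : HasDerivAt (deriv q) (deriv (deriv q) x) x :=
    (hq.differentiable_deriv_two x).hasDerivAt
  have h1c : HasDerivAt (fun x => conj (q x)) (conj (deriv q x)) x := h1.star
  have h2c : HasDerivAt (fun x => conj (deriv q x)) (conj (deriv (deriv q) x)) x := h2.star
  have hn : (‖q x‖ : ℂ) ^ 2 = q x * conj (q x) := (Complex.mul_conj' _).symm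
  have hmul := (h1.mul h1c).const_mul Complex.I
  rw [hasDerivAt_matrix_iff, hn]
  simp only [zsMatrix_eq, timeMatrix, potentialMatrix]
  intro i j
  fin_cases i <;> fin_cases j
  · refine (hmul.const_add _).congr_deriv ?_
    simp [Complex.conj_ofNat]
    ring
  · refine ((h1.const_mul (2 * z)).add (h2.const_mul Complex.I)).congr_deriv ?_
    simp [Complex.conj_ofNat]
    linear_combination 2 * deriv q x * z * Complex.I_sq
  · refine ((h1c.const_mul (2 * z)).neg.add (h2c.const_mul Complex.I)).congr_deriv ?_
    simp [Complex.conj_ofNat]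
    linear_combination (-2) * conj (deriv q x) * z * Complex.I_sq
  · refine (hmul.const_sub _).congr_deriv ?_
    simp [Complex.conj_ofNat]
    ring

/-- If `q` solves the NLS equation, conjugating the time matrix by the principal solution gives a
primitive of the conjugated time derivative of the potential. -/
theorem hasDerivAt_adjugate_mul_timeMatrix_mul {q : ℝ → ℂ} (hq : ContDiff ℝ 2 q) (z : ℂ) (x : ℝ) :
    HasDerivAt (fun x => (principalSolution q x z).adjugate * timeMatrix q z x *
        principalSolution q x z)
      ((principalSolution q x z).adjugate *
        potentialMatrix (Complex.I * (deriv (deriv q) x + 2 * (‖q x‖ : ℂ) ^ 2 * q x)) *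
        principalSolution q x z) x := by
  have h := hasDerivAt_principalSolution hq.continuous z x
  exact (((hasDerivAt_adjugate h).mul (hasDerivAt_timeMatrix hq z x)).mul h).congr_deriv
    (by rw [Pi.mul_apply]; noncomm_ring)

namespace IsPeriodicNLSSolution

variable {L : ℝ} {J : Set ℝ} {q : ℝ → ℝ → ℂ}

theorem derivWithin_eq (hq : IsPeriodicNLSSolution L J q) (x : ℝ) {t : ℝ} (ht : t ∈ J) :
    derivWithin (q x) J t = Complex.I * (deriv (deriv fun y => q y t) x
      + 2 * (‖q x t‖ : ℂ) ^ 2 * q x t) := by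
  linear_combination (-Complex.I) * hq.equation x t ht + derivWithin (q x) J t * Complex.I_sq

theorem timeMatrix_period (hq : IsPeriodicNLSSolution L J q) {t : ℝ} (ht : t ∈ J) (z : ℂ) :
    timeMatrix (fun x => q x t) z L = timeMatrix (fun x => q x t) z 0 := by
  have h1 : q L t = q 0 t := by simpa using hq.periodic t ht 0
  have h2 : deriv (fun x => q x t) L = deriv (fun x => q x t) 0 := by
    have : (fun x => q (x + L) t) = fun x => q x t := funext (hq.periodic t ht)
    have h := deriv_comp_add_const (f := fun x => q x t) L 0
    rw [this, zero_add] at h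
    exact h.symm
  simp only [timeMatrix, h1, h2]

/-- The left side is the variation of constants quotient at `s = t`. Its integrand has the primitive
`Y⁻¹ V Y`, and periodicity of `V` turns the boundary terms into a commutator with `V(0)`. -/
theorem integral_adjugate_mul_timeSlope_mul (hq : IsPeriodicNLSSolution L J q)
    {t : ℝ} (ht : t ∈ J) (z : ℂ) :
    principalSolution (fun x => q x t) L z * ∫ x in (0 : ℝ)..L,
      (principalSolution (fun x => q x t) x z).adjugate *
        potentialMatrix (timeSlope J q t x t) * principalSolution (fun x => q x t) x z
    = timeMatrix (fun x => q x t) z 0 * principalSolution (fun x => q x t) L z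
      - principalSolution (fun x => q x t) L z * timeMatrix (fun x => q x t) z 0 := by
  have hc := hq.continuous_space ht
  have hC := hq.contDiff_space t ht
  have hq2 : Continuous (deriv (deriv fun y => q y t)) := by
    have h := hC.continuous_iteratedDeriv 2 le_rfl
    rwa [iteratedDeriv_succ, iteratedDeriv_one] at h
  have hY := continuous_principalSolution_left hc z
  have hint : Continuous fun x => (principalSolution (fun x => q x t) x z).adjugate *
        potentialMatrix (Complex.I * (deriv (deriv fun y => q y t) x
          + 2 * (‖q x t‖ : ℂ) ^ 2 * q x t)) * principalSolution (fun x => q x t) x z :=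
    (hY.matrix_adjugate.mul (continuous_potentialMatrix.comp (by fun_prop))).mul hY
  simp only [timeSlope, if_true, hq.derivWithin_eq _ ht]
  rw [intervalIntegral.integral_eq_sub_of_hasDerivAt
    (fun x _ => hasDerivAt_adjugate_mul_timeMatrix_mul hC z x) (hint.intervalIntegrable _ _),
    principalSolution_zero hc, hq.timeMatrix_period ht, mul_sub, ← mul_assoc, ← mul_assoc,
    principalSolution_mul_adjugate hc]
  simp

theorem continuous_principalSolution_subtype (hq : IsPeriodicNLSSolution L J q) :
    Continuous fun r : (J × ℂ) × ℝ => principalSolution (fun x => q x r.1.1) r.2 r.1.2 :=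
  continuous_principalSolution (P := J × ℂ) (u := fun p x => q x p.1) (ζ := Prod.snd)
    (hq.continuous_subtype.comp (continuous_snd.prodMk (continuous_fst.comp continuous_fst)))
    continuous_snd

/-- The increment in time of the monodromy matrix is divisible by the time step, with a quotient
continuous in the final time and in the spectral parameter. -/
theorem exists_monodromy_sub_eq_smul (hq : IsPeriodicNLSSolution L J q) (hJ : J.OrdConnected)
    {t : ℝ} (ht : t ∈ J) :
    ∃ G : J × ℂ → Matrix (Fin 2) (Fin 2) ℂ, Continuous G ∧
      (∀ p : J × ℂ, principalSolution (fun x => q x p.1) L p.2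
        - principalSolution (fun x => q x t) L p.2 = ((p.1 : ℝ) - t) • G p) ∧
      ∀ z, G (⟨t, ht⟩, z) =
        timeMatrix (fun x => q x t) z 0 * principalSolution (fun x => q x t) L z
          - principalSolution (fun x => q x t) L z * timeMatrix (fun x => q x t) z 0 := by
  have hc := hq.continuous_space ht
  have hY := continuous_principalSolution_uncurry hc
  refine ⟨fun p => principalSolution (fun x => q x t) L p.2 * ∫ x in (0 : ℝ)..L,
      (principalSolution (fun x => q x t) x p.2).adjugate *
        potentialMatrix (timeSlope J q t x p.1) * principalSolution (fun x => q x p.1) x p.2,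
    ?_, fun p => ?_, fun z => hq.integral_adjugate_mul_timeSlope_mul ht z⟩
  · have h0 : Continuous fun p : J × ℂ => principalSolution (fun x => q x t) L p.2 :=
      Continuous.comp (f := fun p : J × ℂ => (p.2, L)) hY (by fun_prop)
    have h1 : Continuous fun r : (J × ℂ) × ℝ =>
        principalSolution (fun x => q x t) r.2 r.1.2 :=
      Continuous.comp (f := fun r : (J × ℂ) × ℝ => (r.1.2, r.2)) hY (by fun_prop)
    have h2 : Continuous fun r : (J × ℂ) × ℝ => timeSlope J q t r.2 r.1.1 :=
      Continuous.comp (f := fun r : (J × ℂ) × ℝ => (r.2, r.1.1))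
        (hq.continuous_timeSlope hJ ht) (by fun_prop)
    have h3 : Continuous (Function.uncurry fun (p : J × ℂ) (x : ℝ) =>
        (principalSolution (fun x => q x t) x p.2).adjugate *
          potentialMatrix (timeSlope J q t x p.1) *
          principalSolution (fun x => q x p.1) x p.2) :=
      (h1.matrix_adjugate.mul (continuous_potentialMatrix.comp h2)).mul
        hq.continuous_principalSolution_subtype
    exact h0.mul
      (intervalIntegral.continuous_parametric_intervalIntegral_of_continuous' h3 0 L)
  · rw [principalSolution_sub hc (hq.continuous_space p.1.2), ← mul_smul_comm,
      ← intervalIntegral.integral_smul]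
    congr 2
    funext x
    have : zsMatrix (fun x => q x p.1) p.2 x - zsMatrix (fun x => q x t) p.2 x
        = ((p.1 : ℝ) - t) • potentialMatrix (timeSlope J q t x p.1) := by
      have h := sub_eq_smul_timeSlope J q t x p.1
      have h' := congrArg conj h
      simp only [Complex.real_smul, map_sub, map_mul, Complex.conj_ofReal] at h h'
      ext i j
      fin_cases i <;> fin_cases j <;> simp [zsMatrix_eq, potentialMatrix, h]
      push_cast at h'
      linear_combination -h'
    rw [this, mul_smul_comm, smul_mul_assoc]

end IsPeriodicNLSSolution

/-! ### The conjugated monodromy matrix and the sign of a Dirichlet eigenvalue. -/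

theorem inv_sqrt_two_mul_self :
    ((Real.sqrt 2 : ℝ) : ℂ)⁻¹ * ((Real.sqrt 2 : ℝ) : ℂ)⁻¹ = 1 / 2 := by
  rw [← mul_inv, ← Complex.ofReal_mul, Real.mul_self_sqrt (by norm_num)]
  norm_num

theorem inv_similarityU : similarityU⁻¹ =
    ((Real.sqrt 2 : ℝ) : ℂ)⁻¹ • !![1, Complex.I; 1, -Complex.I] := by
  refine Matrix.inv_eq_right_inv ?_
  have h := inv_sqrt_two_mul_self
  rw [similarityU, smul_mul_smul_comm, h]
  ext i j
  fin_cases i <;> fin_cases j <;>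
    simp [← two_mul]

theorem similarityU_conj_apply (M : Matrix (Fin 2) (Fin 2) ℂ) :
    (similarityU * M * similarityU⁻¹) 0 1 = Complex.I / 2 * (M 0 0 + M 1 0 - M 0 1 - M 1 1) ∧
    (similarityU * M * similarityU⁻¹) 1 1 = (M 0 0 + M 1 1 - M 0 1 - M 1 0) / 2 := by
  have h := inv_sqrt_two_mul_self
  rw [inv_similarityU, similarityU, smul_mul_assoc, smul_mul_smul_comm, h]
  constructor
  · simp only [Matrix.smul_apply, Matrix.mul_apply, Fin.sum_univ_two]
    simp
    ring
  · simp only [Matrix.smul_apply, Matrix.mul_apply, Fin.sum_univ_two]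
    simp
    linear_combination (-(M 0 0 + M 1 1 - M 0 1 - M 1 0) / 2) * Complex.I_sq

theorem modifiedSolution_zero_one (q : ℝ → ℂ) (x : ℝ) (z : ℂ) :
    modifiedSolution q x z 0 1 = Complex.I / 2 * (principalSolution q x z 0 0 +
      principalSolution q x z 1 0 - principalSolution q x z 0 1 - principalSolution q x z 1 1) :=
  (similarityU_conj_apply _).1

theorem modifiedSolution_one_one (q : ℝ → ℂ) (x : ℝ) (z : ℂ) :
    modifiedSolution q x z 1 1 = (principalSolution q x z 0 0 + principalSolution q x z 1 1 -
      principalSolution q x z 0 1 - principalSolution q x z 1 0) / 2 :=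
  (similarityU_conj_apply _).2

theorem modifiedSolution_zero_one_eq_zero_iff (q : ℝ → ℂ) (x : ℝ) (z : ℂ) :
    modifiedSolution q x z 0 1 = 0 ↔ principalSolution q x z 0 0 +
      principalSolution q x z 1 0 = principalSolution q x z 0 1 + principalSolution q x z 1 1 := by
  rw [modifiedSolution_zero_one, mul_eq_zero, or_iff_right (by simp), sub_sub, sub_eq_zero]

theorem differentiable_modifiedSolution {q : ℝ → ℂ} (hq : Continuous q) (x : ℝ) :
    Differentiable ℂ fun z => modifiedSolution q x z 0 1 := by
  have h := differentiable_principalSolution_apply hq x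
  simp only [modifiedSolution_zero_one]
  exact ((((h 0 0).add (h 1 0)).sub (h 0 1)).sub (h 1 1)).const_mul _

theorem discriminant_eq (L : ℝ) (q : ℝ → ℂ) (z : ℂ) : discriminant L q z =
    (principalSolution q L z 0 0 + principalSolution q L z 1 1) / 2 := by
  rw [discriminant, Matrix.trace_fin_two]

/-- When `ỹ₁₂` vanishes, `Ỹ(L)` is lower triangular, so `ỹ₂₂` is an eigenvalue of a matrix with
determinant `1` and trace `2Δ`. -/
theorem modifiedSolution_one_one_root {L : ℝ} {q : ℝ → ℂ} (hq : Continuous q) {z : ℂ}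
    (h : modifiedSolution q L z 0 1 = 0) :
    modifiedSolution q L z 1 1 ^ 2 - 2 * discriminant L q z * modifiedSolution q L z 1 1 + 1
      = 0 := by
  have hdet := det_principalSolution hq z L
  rw [Matrix.det_fin_two] at hdet
  rw [modifiedSolution_zero_one_eq_zero_iff] at h
  rw [modifiedSolution_one_one, discriminant_eq]
  set a := principalSolution q L z 0 0
  set b := principalSolution q L z 0 1
  set c := principalSolution q L z 1 0
  set d := principalSolution q L z 1 1
  clear_value a b c d
  obtain rfl : b = a + c - d := by linear_combination -h
  linear_combination -hdet

/-- Here `ỹ₂₂` is `ρ` or `1/ρ`, and the sign records which. On the main spectrum `ρ = 1/ρ` and both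
sides vanish; off the Lax spectrum `|ρ| < 1`, so the sign of `log |ỹ₂₂|` decides. -/
theorem dirichletSign_mul {L : ℝ} {q : ℝ → ℂ} {ρ : ℂ → ℂ} (hρ : IsFloquetMultiplier L q ρ) {z : ℂ}
    (h : modifiedSolution q L z 1 1 ^ 2
      - 2 * discriminant L q z * modifiedSolution q L z 1 1 + 1 = 0) :
    (dirichletSign L q ρ z : ℂ) * (ρ z - (ρ z)⁻¹) =
      modifiedSolution q L z 1 1 - (modifiedSolution q L z 1 1)⁻¹ := by
  have hr := hρ.1 z
  have hr0 : ρ z ≠ 0 := fun h0 => by simp [h0] at hr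
  rw [dirichletSign]
  set w := modifiedSolution q L z 1 1
  set r := ρ z
  have hw : w = r ∨ w = r⁻¹ := by
    have hmul : (w - r) * (w - r⁻¹) = 0 := by
      have h2 : 2 * discriminant L q z = r + r⁻¹ := by
        field_simp
        linear_combination -hr
      rw [h2] at h
      have : r * r⁻¹ = 1 := mul_inv_cancel₀ hr0
      linear_combination h + this
    rcases mul_eq_zero.mp hmul with h' | h'
    · exact Or.inl (sub_eq_zero.mp h')
    · exact Or.inr (sub_eq_zero.mp h')
  split_ifs with h1 h2 h3
  · simp [h2]
  · simp [h3]
  -- The default value `0` of the sign on the Lax spectrum is never reached.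
  · exact absurd hw (by simp [h2, h3])
  · by_cases hm : z ∈ mainSpectrum L q
    · have hm' : discriminant L q z ^ 2 - 1 = 0 := hm
      have hr1 : r = discriminant L q z := by
        have : (r - discriminant L q z) ^ 2 = 0 := by linear_combination hr + hm'
        exact sub_eq_zero.mp (pow_eq_zero_iff two_ne_zero |>.mp this)
      have hr2 : r * r = 1 := by rw [hr1]; linear_combination hm'
      have hr3 : r⁻¹ = r := inv_eq_of_mul_eq_one_left hr2
      have hw' : w = r := by rcases hw with h | h <;> simp [h, hr3]
      simp [hw', hr3]
    · have hlt : ‖r‖ < 1 := hρ.2 z fun hz => h1 ⟨hz, hm⟩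
      have hpos : 0 < ‖r‖ := norm_pos_iff.mpr hr0
      have hlog : Real.log ‖r‖ < 0 := Real.log_neg hpos hlt
      rcases hw with h | h
      · simp [h, sign_neg hlog]
      · simp [h, hlog]

theorem dirichletSign_eq_zero {L : ℝ} {q : ℝ → ℂ} {ρ : ℂ → ℂ} {z : ℂ}
    (h : modifiedSolution q L z 1 1 ^ 2
      - 2 * discriminant L q z * modifiedSolution q L z 1 1 + 1 = 0) (hm : z ∈ mainSpectrum L q) :
    dirichletSign L q ρ z = 0 := by
  have hm' : discriminant L q z ^ 2 - 1 = 0 := hm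
  rw [dirichletSign, if_neg fun hz => hz.2 hm]
  set w := modifiedSolution q L z 1 1
  have hw : w = discriminant L q z := by
    have : (w - discriminant L q z) ^ 2 = 0 := by linear_combination h + hm'
    exact sub_eq_zero.mp (pow_eq_zero_iff two_ne_zero |>.mp this)
  have hn : ‖w‖ ^ 2 = 1 := by
    rw [← norm_pow, hw, sub_eq_zero.mp hm', norm_one]
  have hn1 : ‖w‖ = 1 := by
    rwa [pow_eq_one_iff_of_nonneg (norm_nonneg _) two_ne_zero] at hn
  simp [hn1]

/-! ### The Dirichlet spectrum as the zero set of `ỹ₁₂`. -/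

theorem diracExpr_eq_smul_iff (q : ℝ → ℂ) (x : ℝ) (v w : Fin 2 → ℂ) (z : ℂ) :
    diracExpr q x v w = z • v ↔ w = zsMatrix q z x *ᵥ v := by
  have hI := Complex.I_sq
  simp only [diracExpr, zsMatrix_eq, sigma3, potentialMatrix, funext_iff, Fin.forall_fin_two,
    Pi.smul_apply, Pi.sub_apply, Matrix.mulVec, dotProduct, Fin.sum_univ_two]
  simp
  constructor
  · rintro ⟨h0, h1⟩
    constructor
    · linear_combination -Complex.I * h0 + (w 0 - q x * v 1) * hI
    · linear_combination Complex.I * h1 + (w 1 + conj (q x) * v 0) * hI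
  · rintro ⟨h0, h1⟩
    constructor
    · linear_combination Complex.I * h0 - z * v 0 * hI
    · linear_combination -Complex.I * h1 - z * v 1 * hI

/-- An `H¹` solution satisfies the system only almost everywhere; substituting the system into the
integral of `w` makes the integrand continuous and `v` a classical solution. -/
theorem eq_principalSolution_mulVec {q : ℝ → ℂ} (hq : Continuous q) {z : ℂ} {L : ℝ} (hL : 0 ≤ L)
    {v w : ℝ → Fin 2 → ℂ} (hvw : IsH1With 0 L v w)
    (h : ∀ᵐ x ∂volume.restrict (Icc 0 L), w x = zsMatrix q z x *ᵥ v x) {x : ℝ}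
    (hx : x ∈ Icc 0 L) : v x = principalSolution q x z *ᵥ v 0 := by
  obtain ⟨hw, hv⟩ := hvw
  have hwi : IntegrableOn w (Icc 0 L) := hw.integrable (by norm_num)
  have hvc : ContinuousOn v (Icc 0 L) := by
    have h1 : ContinuousOn (fun x => v 0 + ∫ s in (0 : ℝ)..x, w s) (Icc 0 L) :=
      continuousOn_const.add (by
        simpa [uIcc_of_le hL] using intervalIntegral.continuousOn_primitive_interval
          (a := 0) (b := L) (μ := volume) (f := w) (by rwa [uIcc_of_le hL]))
    exact h1.congr hv
  -- Extending `v` by its end values keeps the integrand continuous on the line, so that the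
  -- primitive has two-sided derivatives at `0` and `L` too.
  set V : ℝ → Fin 2 → ℂ := IccExtend hL ((Icc 0 L).domRestrict v) with hV
  have hVc : Continuous V := (continuousOn_iff_continuous_domRestrict.mp hvc).Icc_extend'
  have hVv : ∀ s ∈ Icc 0 L, V s = v s := fun s hs => IccExtend_of_mem hL _ hs
  have hA : Continuous fun s => zsMatrix q z s *ᵥ V s :=
    (continuous_zsMatrix_left hq z).matrix_mulVec hVc
  have hvu : ∀ x ∈ Icc 0 L, v x = v 0 + ∫ s in (0 : ℝ)..x, zsMatrix q z s *ᵥ V s := by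
    intro x hx
    rw [hv x hx]
    congr 1
    refine intervalIntegral.integral_congr_ae ?_
    filter_upwards [(ae_restrict_iff' measurableSet_Icc).mp h] with s hs hs'
    rw [uIoc_of_le hx.1] at hs'
    have hsL : s ∈ Icc 0 L := ⟨hs'.1.le, hs'.2.trans hx.2⟩
    rw [hs hsL, hVv s hsL]
  -- The vector solution is put into both columns of a matrix, so that the matrix product rule
  -- applies.
  set W : ℝ → Matrix (Fin 2) (Fin 2) ℂ :=
    fun x => Matrix.of fun i _ => (v 0 + ∫ s in (0 : ℝ)..x, zsMatrix q z s *ᵥ V s) i with hW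
  have hWv : ∀ x ∈ Icc 0 L, ∀ i j, W x i j = v x i := fun x hx i j => by
    rw [hvu x hx]; rfl
  have hWd : ∀ x ∈ Icc 0 L, HasDerivAt W (zsMatrix q z x * W x) x := by
    intro x hx
    rw [hasDerivAt_matrix_iff]
    intro i j
    have h1 := (hA.integral_hasStrictDerivAt 0 x).hasDerivAt.const_add (v 0)
    refine ((hasDerivAt_pi.mp h1) i).congr_deriv ?_
    rw [hVv x hx, Matrix.mul_apply, Matrix.mulVec, dotProduct]
    exact Finset.sum_congr rfl fun k _ => by rw [hWv x hx]
  have hd : ∀ x ∈ Icc 0 L,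
      HasDerivAt (fun x => (principalSolution q x z).adjugate * W x) 0 x := fun x hx =>
    ((hasDerivAt_adjugate (hasDerivAt_principalSolution hq z x)).mul (hWd x hx)).congr_deriv
      (by noncomm_ring)
  have hconst := constant_of_has_deriv_right_zero
    (fun x hx => (hd x hx).continuousAt.continuousWithinAt)
    (fun x hx => (hd x (Ico_subset_Icc_self hx)).hasDerivWithinAt) x hx
  have hWx : W x = principalSolution q x z * W 0 := by
    have h1 : (principalSolution q x z).adjugate * W x = W 0 := by
      simpa [principalSolution_zero hq] using hconst
    rw [← h1, ← mul_assoc, principalSolution_mul_adjugate hq, one_mul]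
  ext i
  rw [← hWv x hx i 0, hWx, Matrix.mul_apply, Matrix.mulVec, dotProduct]
  exact Finset.sum_congr rfl fun k _ => by rw [hWv 0 ⟨le_rfl, hL⟩]

/-- The condition at `0` forces `v(0)` to be a multiple of `(1, -1)`. The row `(1, 1)` applied to
`Y(L) (1, -1)` is `ỹ₁₂(L)` up to a nonzero factor. -/
theorem mem_dirichletSpectrum_iff {q : ℝ → ℂ} (hq : Continuous q) {z : ℂ} {L : ℝ} (hL : 0 ≤ L) :
    z ∈ dirichletSpectrum L q 0 ↔ modifiedSolution q L z 0 1 = 0 := by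
  rw [modifiedSolution_zero_one_eq_zero_iff]
  simp only [dirichletSpectrum, zero_add, diracExpr_eq_smul_iff, mem_ofPred_eq]
  constructor
  · rintro ⟨v, w, hvw, ⟨x, hx, hvx⟩, hae, h0, h1⟩
    have hsol : ∀ {x}, x ∈ Icc 0 L → v x = principalSolution q x z *ᵥ v 0 := fun hx =>
      eq_principalSolution_mulVec hq hL hvw hae hx
    have hv1 : v 0 1 = -v 0 0 := by linear_combination h0
    have hne : v 0 0 ≠ 0 := fun h => hvx (by
      have : v 0 = 0 := by
        ext i
        fin_cases i
        · exact h
        · simp [hv1, h]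
      rw [hsol hx, this, Matrix.mulVec_zero])
    rw [hsol ⟨hL, le_rfl⟩] at h1
    simp only [Matrix.mulVec, dotProduct, Fin.sum_univ_two, hv1] at h1
    refine mul_right_cancel₀ hne ?_
    linear_combination h1
  · intro h
    have hY := continuous_principalSolution_left hq z
    set v : ℝ → Fin 2 → ℂ := fun x => principalSolution q x z *ᵥ ![1, -1] with hv
    have hvc : Continuous v := hY.matrix_mulVec continuous_const
    have hwc : Continuous fun x => zsMatrix q z x *ᵥ v x := (continuous_zsMatrix_left hq z).matrix_mulVec hvc
    have hv0 : v 0 = ![1, -1] := by simp [hv, principalSolution_zero hq]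
    have hvd : ∀ x, HasDerivAt v (zsMatrix q z x *ᵥ v x) x := fun x => by
      rw [hasDerivAt_pi]
      intro i
      have hd := hasDerivAt_matrix_iff.mp (hasDerivAt_principalSolution hq z x) i
      refine (((hd 0).mul_const 1).add
        ((hd 1).mul_const (-1))).congr_deriv ?_ |>.congr_of_eventuallyEq (Eventually.of_forall fun y => ?_)
      · simp only [hv, Matrix.mulVec_mulVec]
        simp [Matrix.mulVec, dotProduct, Fin.sum_univ_two]
      · simp only [hv, Matrix.mulVec, dotProduct, Fin.sum_univ_two]
        simp
    refine ⟨v, fun x => zsMatrix q z x *ᵥ v x, ⟨?_, fun x _ => ?_⟩,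
      ⟨0, ⟨le_rfl, hL⟩, fun h0 => ?_⟩, Eventually.of_forall fun _ => rfl, ?_, ?_⟩
    · obtain ⟨C, hC⟩ := (isCompact_Icc (a := 0) (b := L)).exists_bound_of_continuousOn
        hwc.continuousOn
      exact MemLp.of_bound hwc.aestronglyMeasurable C
        ((ae_restrict_mem measurableSet_Icc).mono hC)
    · rw [intervalIntegral.integral_eq_sub_of_hasDerivAt (fun x _ => hvd x)
        (hwc.intervalIntegrable _ _), add_sub_cancel]
    · rw [hv0] at h0
      simpa using congrFun h0 0
    · simp [hv0]
    · simp only [hv, Matrix.mulVec, dotProduct, Fin.sum_univ_two, Matrix.cons_val_zero,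
        Matrix.cons_val_one]
      linear_combination h

/-- For real spectral parameter the principal solution takes values in `SU(2)`. -/
theorem principalSolution_conj_of_im_eq_zero {q : ℝ → ℂ} (hq : Continuous q) {z : ℂ}
    (hz : z.im = 0) (x : ℝ) :
    principalSolution q x z 1 1 = conj (principalSolution q x z 0 0) ∧
      principalSolution q x z 1 0 = -conj (principalSolution q x z 0 1) := by
  have hzc : conj z = z := Complex.conj_eq_iff_im.mpr hz
  have hd := hasDerivAt_principalSolution hq z
  -- This matrix is the conjugate transpose of the adjugate of `Y`. For real `z` the coefficient
  -- matrix is skew-Hermitian, so it solves the same system and uniqueness applies.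
  have hW : IsPrincipalSolution q z fun x =>
      !![conj (principalSolution q x z 1 1), -conj (principalSolution q x z 1 0);
        -conj (principalSolution q x z 0 1), conj (principalSolution q x z 0 0)] := by
    refine isPrincipalSolution_iff.mpr ⟨?_, fun x => ?_⟩
    · ext i j
      fin_cases i <;> fin_cases j <;> simp [principalSolution_zero hq]
    · have h := fun i j => (hasDerivAt_matrix_iff.mp (hd x) i j).star
      rw [hasDerivAt_matrix_iff]
      simp only [zsMatrix_eq, Matrix.mul_apply, Fin.sum_univ_two] at h ⊢
      intro i j
      fin_cases i <;> fin_cases j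
      · refine (h 1 1).congr_deriv ?_
        simp [hzc]
        ring
      · refine (h 1 0).neg.congr_deriv ?_
        simp [hzc]
      · refine (h 0 1).neg.congr_deriv ?_
        simp [hzc]
      · refine (h 0 0).congr_deriv ?_
        simp [hzc]
        ring
  have h := principalSolution_eq hW x
  constructor
  · simpa using congrFun (congrFun h 1) 1
  · simpa using congrFun (congrFun h 1) 0

/-- A matrix in `SU(2)` with trace `±2` is `±1`: the condition `(re a)² = 1` exhausts `|a|² + |b|² =
1`. -/
theorem modifiedSolution_eq_zero_of_mem_mainSpectrum {L : ℝ} {q : ℝ → ℂ} (hq : Continuous q)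
    {z : ℂ} (hz : z.im = 0) (hm : z ∈ mainSpectrum L q) : modifiedSolution q L z 0 1 = 0 := by
  obtain ⟨h1, h2⟩ := principalSolution_conj_of_im_eq_zero hq hz L
  have hdet := det_principalSolution hq z L
  have hm' : discriminant L q z ^ 2 - 1 = 0 := hm
  rw [Matrix.det_fin_two, h1, h2] at hdet
  rw [discriminant_eq, h1] at hm'
  rw [modifiedSolution_zero_one_eq_zero_iff, h1, h2]
  set a := principalSolution q L z 0 0
  set b := principalSolution q L z 0 1
  have e1 : a.re ^ 2 = 1 := by
    have : (a + conj a) / 2 = (a.re : ℂ) := by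
      rw [Complex.add_conj]; push_cast; ring
    rw [this, sub_eq_zero] at hm'
    exact_mod_cast hm'
  have e2 : a.re ^ 2 + a.im ^ 2 + (b.re ^ 2 + b.im ^ 2) = 1 := by
    rw [mul_neg, sub_neg_eq_add, Complex.mul_conj, Complex.mul_conj] at hdet
    have : Complex.normSq a + Complex.normSq b = 1 := by exact_mod_cast hdet
    rw [Complex.normSq_apply, Complex.normSq_apply] at this
    linear_combination this
  have ha : a.im = 0 := by nlinarith [sq_nonneg b.re, sq_nonneg b.im, sq_nonneg a.im]
  have hb1 : b.re = 0 := by nlinarith [sq_nonneg b.re, sq_nonneg b.im, sq_nonneg a.im]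
  have hb2 : b.im = 0 := by nlinarith [sq_nonneg b.re, sq_nonneg b.im, sq_nonneg a.im]
  have hb : b = 0 := Complex.ext hb1 hb2
  rw [hb, Complex.conj_eq_iff_im.mpr ha]
  simp

/-- In the conjugated frame `M` is lower triangular, so the entry of `[V, M]` is `ṽ₁₂ (m̃₂₂ -
m̃₁₁)`; here `ṽ₁₂ = -c₁`, and `m̃₁₁ = 1/m̃₂₂` by the determinant. -/
theorem commutator_timeMatrix_apply (q : ℝ → ℝ → ℂ) (t : ℝ) (z : ℂ)
    {M : Matrix (Fin 2) (Fin 2) ℂ} (hdet : M.det = 1)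
    (hM : (similarityU * M * similarityU⁻¹) 0 1 = 0) :
    (similarityU * (timeMatrix (fun x => q x t) z 0 * M - M * timeMatrix (fun x => q x t) z 0)
      * similarityU⁻¹) 0 1 = -(c1 q t z * ((similarityU * M * similarityU⁻¹) 1 1
        - ((similarityU * M * similarityU⁻¹) 1 1)⁻¹)) := by
  rw [(similarityU_conj_apply M).1, mul_eq_zero, or_iff_right (by simp)] at hM
  rw [Matrix.det_fin_two] at hdet
  rw [(similarityU_conj_apply _).1, (similarityU_conj_apply M).2, c1, ← Complex.mul_conj']
  simp only [Matrix.sub_apply, Matrix.mul_apply, Fin.sum_univ_two]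
  simp only [timeMatrix, Matrix.of_apply, Matrix.cons_val_zero, Matrix.cons_val_one,
    Matrix.cons_val', Matrix.cons_val_fin_one]
  set a := M 0 0
  set b := M 0 1
  set c := M 1 0
  set d := M 1 1
  clear_value a b c d
  obtain rfl : b = a + c - d := by linear_combination -hM
  have hw : (a + d - (a + c - d) - c) / 2 = d - c := by ring
  have hinv : (d - c)⁻¹ = a + c := by
    refine inv_eq_of_mul_eq_one_left ?_
    linear_combination hdet
  rw [hw, hinv]
  generalize deriv (fun x => q x t) 0 = r
  generalize q 0 t = p
  linear_combination ((2 * z ^ 2 - p * conj p) * (a - d + 2 * c)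
    - (a - d + 2 * c) / 2 * (conj r - r)) * Complex.I_sq

/-! ### Motion of the Dirichlet eigenvalues. -/

namespace IsPeriodicNLSSolution

variable {L : ℝ} {J : Set ℝ} {q : ℝ → ℝ → ℂ}

/-- The Floquet discriminant does not depend on time. -/
theorem discriminant_eq_discriminant (hq : IsPeriodicNLSSolution L J q) (hJ : J.OrdConnected)
    {s t : ℝ} (hs : s ∈ J) (ht : t ∈ J) (z : ℂ) :
    discriminant L (fun x => q x s) z = discriminant L (fun x => q x t) z := by
  have hd : ∀ t ∈ J, HasDerivWithinAt (fun s => discriminant L (fun x => q x s) z) 0 J t := by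
    intro t ht
    obtain ⟨G, hG, hsub, hGt⟩ := hq.exists_monodromy_sub_eq_smul hJ ht
    classical
    -- The value `0` outside `J` is irrelevant, since derivatives are taken relative to `J`.
    set g : ℝ → ℂ := fun s => if h : s ∈ J then (G (⟨s, h⟩, z)).trace / 2 else 0 with hg
    have hgc : ContinuousOn g J := by
      rw [continuousOn_iff_continuous_domRestrict]
      have : J.domRestrict g = fun s : J => (G (s, z)).trace / 2 := by
        funext s
        simp [hg, s.2]
      rw [this]
      exact ((hG.comp (Continuous.prodMk_left z)).matrix_trace).div_const 2
    have h := hasDerivWithinAt_of_sub_eq_smul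
      (f := fun s => discriminant L (fun x => q x s) z) (g := g) (fun s hs => ?_) (hgc t ht)
    · refine h.congr_deriv ?_
      simp only [hg, dif_pos ht, hGt]
      rw [Matrix.trace_sub, Matrix.trace_mul_comm, sub_self, zero_div]
    · simp only [hg, dif_pos hs, discriminant]
      rw [← sub_div, ← Matrix.trace_sub, hsub (⟨s, hs⟩, z), Matrix.trace_smul, smul_div_assoc]
  have h := hJ.convex.norm_image_sub_le_of_norm_hasDerivWithin_le hd (C := 0) (by simp) ht hs
  rw [zero_mul, norm_le_zero_iff, sub_eq_zero] at h
  exact h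

/-- Splitting `ỹ₁₂(s, μ(s)) - ỹ₁₂(t, μ(t)) = 0` at `ỹ₁₂(t, μ(s))` gives `(s - t) g(s) + (μ(s) -
μ(t)) D(s) = 0`, where `D` is the divided difference of `ỹ₁₂(t, ·)`. Near `t` one may divide by `D`.
Continuity of `μ` is given, so no implicit function theorem is needed; joint continuity of `G`
matters because `g` evaluates it at the moving point `μ(s)`. -/
theorem hasDerivWithinAt_dirichlet (hq : IsPeriodicNLSSolution L J q) (hL : 0 ≤ L)
    (hJ : J.OrdConnected) {μ : ℝ → ℂ} (hμ : ContinuousOn μ J)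
    (hDir : ∀ t ∈ J, μ t ∈ dirichletSpectrum L (fun x => q x t) 0) {t : ℝ} (ht : t ∈ J)
    (hne : deriv (fun z => modifiedSolution (fun x => q x t) L z 0 1) (μ t) ≠ 0) :
    HasDerivWithinAt μ (c1 q t (μ t) * (modifiedSolution (fun x => q x t) L (μ t) 1 1
      - (modifiedSolution (fun x => q x t) L (μ t) 1 1)⁻¹)
        / deriv (fun z => modifiedSolution (fun x => q x t) L z 0 1) (μ t)) J t := by
  obtain ⟨G, hG, hsub, hGt⟩ := hq.exists_monodromy_sub_eq_smul hJ ht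
  have hc := hq.continuous_space ht
  have hzero : ∀ s ∈ J, modifiedSolution (fun x => q x s) L (μ s) 0 1 = 0 := fun s hs =>
    (mem_dirichletSpectrum_iff (hq.continuous_space hs) hL).mp (hDir s hs)
  set F : ℂ → ℂ := fun z => modifiedSolution (fun x => q x t) L z 0 1 with hF
  have hFd : DifferentiableAt ℂ F (μ t) := differentiable_modifiedSolution hc L (μ t)
  classical
  set g : ℝ → ℂ := fun s =>
    if h : s ∈ J then (similarityU * G (⟨s, h⟩, μ s) * similarityU⁻¹) 0 1 else 0 with hg
  have hgc : ContinuousOn g J := by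
    rw [continuousOn_iff_continuous_domRestrict]
    have : J.domRestrict g = fun s : J =>
        (similarityU * G (s, μ s) * similarityU⁻¹) 0 1 := by
      funext s
      simp [hg, s.2]
    rw [this]
    have hGc : Continuous fun s : J => G (s, μ s) :=
      Continuous.comp (f := fun s : J => (s, μ s)) hG
        (continuous_id.prodMk (continuousOn_iff_continuous_domRestrict.mp hμ))
    exact ((continuous_const.mul hGc).mul continuous_const).matrix_elem 0 1
  have hS : ContinuousWithinAt (fun s => dslope F (μ t) (μ s)) J t :=
    ContinuousAt.comp_continuousWithinAt (f := μ) (g := dslope F (μ t))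
      (continuousAt_dslope_same.mpr hFd) (hμ t ht)
  have hSt : dslope F (μ t) (μ t) = deriv F (μ t) := dslope_same _ _
  have hSne : dslope F (μ t) (μ t) ≠ 0 := by rwa [hSt]
  have hev : {s | dslope F (μ t) (μ s) ≠ 0} ∈ 𝓝[J] t :=
    hS.eventually_ne hSne
  have hmem : J ∩ {s | dslope F (μ t) (μ s) ≠ 0} ∈ 𝓝[J] t :=
    inter_mem self_mem_nhdsWithin hev
  refine HasDerivWithinAt.mono_of_mem_nhdsWithin (t := J ∩ {s | dslope F (μ t) (μ s) ≠ 0})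
    ?_ hmem
  have h := hasDerivWithinAt_of_sub_eq_smul (f := μ)
    (g := fun s => -g s / dslope F (μ t) (μ s)) (s := J ∩ {s | dslope F (μ t) (μ s) ≠ 0}) (x := t)
    (fun s hs => ?_)
    (((hgc t ht).neg.div hS hSne).mono inter_subset_left)
  · refine h.congr_deriv ?_
    simp only [hg, dif_pos ht, hGt, hSt]
    rw [commutator_timeMatrix_apply q t (μ t) (det_principalSolution hc (μ t) L) (hzero t ht),
      neg_neg]
    rfl
  · have h1 : modifiedSolution (fun x => q x s) L (μ s) 0 1 - F (μ s) = (s - t) • g s := by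
      simp only [hg, dif_pos hs.1, hF, modifiedSolution]
      rw [← Matrix.sub_apply, ← sub_mul, ← mul_sub, hsub (⟨s, hs.1⟩, μ s), mul_smul_comm,
        smul_mul_assoc, Matrix.smul_apply]
    have h2 := sub_smul_dslope F (μ t) (μ s)
    have h3 : F (μ t) = 0 := hzero t ht
    rw [hzero s hs.1] at h1
    rw [h3, sub_zero, smul_eq_mul] at h2
    rw [Complex.real_smul] at h1 ⊢
    rw [mul_div_assoc', eq_div_iff hs.2, h2]
    linear_combination -h1

theorem continuous_modifiedSolution_subtype (hq : IsPeriodicNLSSolution L J q) :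
    Continuous fun r : J × ℂ => modifiedSolution (fun x => q x r.1) L r.2 0 1 := by
  have h : Continuous fun r : J × ℂ => principalSolution (fun x => q x r.1) L r.2 :=
    Continuous.comp (f := fun r : J × ℂ => (r, L)) hq.continuous_principalSolution_subtype
      (by fun_prop)
  exact ((continuous_const.mul h).mul continuous_const).matrix_elem 0 1

/-- A Dirichlet eigenvalue which is a multiple zero of `ỹ₁₂` sits at a real multiple point of the
main spectrum. -/
theorem exists_main_order (hq : IsPeriodicNLSSolution L J q) (hL : 0 ≤ L) {t : ℝ} (ht : t ∈ J)
    (hmult : DirichletMultiplicities L fun x => q x t) {z : ℂ}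
    (hz : z ∈ dirichletSpectrum L (fun x => q x t) 0)
    (hd : deriv (fun z => modifiedSolution (fun x => q x t) L z 0 1) z = 0) :
    ∃ m : ℕ, z.im = 0 ∧ 2 < m ∧
      analyticOrderAt (fun z => discriminant L (fun x => q x t) z ^ 2 - 1) z = (m : ℕ∞) := by
  by_contra hno
  have h1 := (hmult z hz).2 hno
  have hc := hq.continuous_space ht
  have h0 := (mem_dirichletSpectrum_iff hc hL).mp hz
  have han := (differentiable_modifiedSolution hc L).analyticAt z
  have h2 := han.analyticOrderAt_deriv_add_one
  simp only [h0, sub_zero] at h2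
  rw [h1] at h2
  exact han.deriv.analyticOrderAt_ne_zero.mpr hd
    ((ENat.add_left_injective_of_ne_top (by simp : (1 : ℕ∞) ≠ ⊤)) (by simpa using h2))

/-- The order `m` of `Δ² - 1` at the real point `μ t` is the same at all times, so this point is
always a Dirichlet eigenvalue, of fixed order `m/2`. Zeros of `ỹ₁₂` cannot approach it without
raising that order, and continuity pins `μ` there. -/
theorem eventually_eq_of_multiple (hq : IsPeriodicNLSSolution L J q) (hL : 0 ≤ L)
    (hJ : J.OrdConnected) {μ : ℝ → ℂ} (hμ : ContinuousOn μ J)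
    (hDir : ∀ t ∈ J, μ t ∈ dirichletSpectrum L (fun x => q x t) 0)
    (hmult : ∀ s ∈ J, DirichletMultiplicities L fun x => q x s) {t : ℝ} (ht : t ∈ J) {m : ℕ}
    (him : (μ t).im = 0) (hm : 2 < m)
    (hord : analyticOrderAt (fun z => discriminant L (fun x => q x t) z ^ 2 - 1) (μ t) = m) :
    μ =ᶠ[𝓝[J] t] fun _ => μ t := by
  have hmain : μ t ∈ mainSpectrum L fun x => q x t :=
    apply_eq_zero_of_analyticOrderAt_ne_zero
      (f := fun z => discriminant L (fun x => q x t) z ^ 2 - 1)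
      (by rw [hord]; exact_mod_cast (by omega : m ≠ 0))
  have hdisc : ∀ s ∈ J, (fun z => discriminant L (fun x => q x s) z ^ 2 - 1)
      = fun z => discriminant L (fun x => q x t) z ^ 2 - 1 := fun s hs =>
    funext fun z => by rw [hq.discriminant_eq_discriminant hJ hs ht z]
  have h2 : ∀ s ∈ J, 2 * analyticOrderAt
      (fun z => modifiedSolution (fun x => q x s) L z 0 1) (μ t) = (m : ℕ∞) := by
    intro s hs
    have hms : μ t ∈ mainSpectrum L fun x => q x s := by
      have := congrFun (hdisc s hs) (μ t)
      exact this.trans hmain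
    have hmem : μ t ∈ dirichletSpectrum L (fun x => q x s) 0 :=
      (mem_dirichletSpectrum_iff (hq.continuous_space hs) hL).mpr
        (modifiedSolution_eq_zero_of_mem_mainSpectrum (hq.continuous_space hs) him hms)
    exact (hmult s hs (μ t) hmem).1 m him hm (by rw [hdisc s hs, hord])
  -- Twice the order is the natural number `m`, so the order is finite.
  obtain ⟨k, hk⟩ : ∃ k : ℕ, analyticOrderAt
      (fun z => modifiedSolution (fun x => q x t) L z 0 1) (μ t) = k := by
    refine (ENat.ne_top_iff_exists.mp fun htop => ?_).imp fun _ h => h.symm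
    have := h2 t ht
    rw [htop] at this
    simp at this
  have hall : ∀ s : J, analyticOrderAt
      (fun z => modifiedSolution (fun x => q x s) L z 0 1) (μ t) = k := by
    intro s
    have h := (h2 s s.2).trans (h2 t ht).symm
    rw [hk] at h
    exact (ENat.mul_right_strictMono (by simp) (by simp)).injective h
  have hev := eventually_eq_of_zero_of_analyticOrderAt_eq
    (F := fun (s : J) z => modifiedSolution (fun x => q x s) L z 0 1)
    hq.continuous_modifiedSolution_subtype
    (fun s => differentiable_modifiedSolution (hq.continuous_space s.2) L) hall ⟨t, ht⟩
  have hcont : Continuous fun s : J => (s, μ s) :=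
    continuous_id.prodMk (continuousOn_iff_continuous_domRestrict.mp hμ)
  have hev' := (hcont.tendsto ⟨t, ht⟩).eventually hev
  rw [← map_nhds_subtype_val ⟨t, ht⟩]
  exact hev'.mono fun s hs => hs
    ((mem_dirichletSpectrum_iff (hq.continuous_space s.2) hL).mp (hDir s s.2))

end IsPeriodicNLSSolution

end

end ZakharovShabat

theorem proposition5p1 (L : ℝ) (hL : 0 < L) (J : Set ℝ) (hJ : J.OrdConnected)
    (q : ℝ → ℝ → ℂ) (hq : IsPeriodicNLSSolution L J q)
    (ρ : ℝ → ℂ → ℂ) (hρ : ∀ t ∈ J, IsFloquetMultiplier L (fun x => q x t) (ρ t))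
    (μ : ℤ → ℝ → ℂ) (hμ : ∀ n, ContinuousOn (μ n) J)
    (hDir : ∀ n, ∀ t ∈ J, μ n t ∈ dirichletSpectrum L (fun x => q x t) 0) :
    ∀ n, ∀ t ∈ J,
      (deriv (fun z => modifiedSolution (fun x => q x t) L z 0 1) (μ n t) ≠ 0 →
        HasDerivWithinAt (μ n)
          ((dirichletSign L (fun x => q x t) (ρ t) (μ n t) : ℂ) * c1 q t (μ n t)
            * ((ρ t (μ n t) - (ρ t (μ n t))⁻¹)
              / deriv (fun z => modifiedSolution (fun x => q x t) L z 0 1) (μ n t))) J t) ∧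
      ((∀ s ∈ J, DirichletMultiplicities L (fun x => q x s)) →
        deriv (fun z => modifiedSolution (fun x => q x t) L z 0 1) (μ n t) = 0 →
          dirichletSign L (fun x => q x t) (ρ t) (μ n t) = 0 ∧ HasDerivWithinAt (μ n) 0 J t) := by
  intro n t ht
  have hc := hq.continuous_space ht
  have hroot := modifiedSolution_one_one_root hc
    ((mem_dirichletSpectrum_iff hc hL.le).mp (hDir n t ht))
  refine ⟨fun hne => ?_, fun hmult hd => ?_⟩
  · refine (hq.hasDerivWithinAt_dirichlet hL.le hJ (hμ n) (hDir n) ht hne).congr_deriv ?_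
    rw [← dirichletSign_mul (hρ t ht) hroot]
    ring
  · obtain ⟨m, him, hm, hord⟩ := hq.exists_main_order hL.le ht (hmult t ht) (hDir n t ht) hd
    refine ⟨dirichletSign_eq_zero hroot ?_, ?_⟩
    · exact apply_eq_zero_of_analyticOrderAt_ne_zero
        (f := fun z => discriminant L (fun x => q x t) z ^ 2 - 1)
        (by rw [hord]; exact_mod_cast (by omega : m ≠ 0))
    · exact (hasDerivWithinAt_const t J (μ n t)).congr_of_eventuallyEq
        (hq.eventually_eq_of_multiple hL.le hJ (hμ n) (hDir n) hmult ht him hm hord) rfl
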